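/- Let $M$ be a compact connected smooth manifold of dimension $n\ge 1$ with (possibly empty) boundary, and let $g$ be a smooth Riemannian metric on $M$. Let $SM\subset TM$ be the bundle of $g$-unit tangent vectors and let $v^g$ be the geodesic vector field, which in local coordinates (position $x$, velocity $p$) on $TM$ is $v^g(x,p)=(p,-\Gamma_x(p,p))$, where $\Gamma$ denotes the Christoffel symbols of $g$; it is tangent to $SM$. A trajectory of the geodesic flow is the image in $SM$ of an integral curve of $v^g$ in $SM$, defined on an interval of any kind (a single point is allowed), that does not extend to an integral curve in $SM$ on a larger interval; it carries the subspace topology. Geodesics are the projections to $M$ of the integral curves of $v^g$ in $SM$. The metric $g$ is of \emph{gradient type} if there is a smooth function $F:SM\to\mathbb R$ with $dF(v^g)>0$ everywhere on $SM$. The metric $g$ is \emph{non-trapping} if $(M,g)$ has no closed geodesics (no integral curve $\mathbb R\to SM$ of $v^g$ is periodic) and no geodesics of infinite length. Then $g$ is of gradient type if and only if every trajectory of the geodesic flow is homeomorphic to a closed interval or is a singleton. In other words, $g$ is of gradient type if and only if $g$ is non-trapping. -/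

import Mathlib

open scoped Manifold ContDiff Topology ENNReal

noncomputable section

namespace GeodesicFlow

variable {E : Type*} [NormedAddCommGroup E] [NormedSpace ℝ E] {H : Type*} [TopologicalSpace H]
  {I : ModelWithCorners ℝ E H} {M : Type*} [TopologicalSpace M] [ChartedSpace H M]
  [IsManifold I ∞ M]

/-- A smooth Riemannian metric on the manifold `M`. -/
abbrev Metric (I : ModelWithCorners ℝ E H) (M : Type*) [TopologicalSpace M] [ChartedSpace H M]
    [IsManifold I ∞ M] : Type _ :=
  Bundle.ContMDiffRiemannianMetric I ∞ E (fun x : M => TangentSpace I x)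

/-- The unit tangent bundle `SM`, as a subset of the tangent bundle `TM`. -/
def unitTangent (g : Metric I M) : Set (TangentBundle I M) :=
  {w | g.inner w.proj w.snd w.snd = 1}

/-- The metric read in the preferred chart `φ` at `x`: at a point `y` of the model space it is the
bilinear form `(a, b) ↦ g (dφ⁻¹ a) (dφ⁻¹ b)`, i.e. the matrix `(g_{αβ}(y))`. -/
def metricInChart (g : Metric I M) (x : M) (y : E) : E →L[ℝ] E →L[ℝ] ℝ :=
  let A : E →L[ℝ] E := mfderiv[Set.range I] (extChartAt I x).symm y
  let B : E →L[ℝ] E →L[ℝ] ℝ := g.inner ((extChartAt I x).symm y)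
  B.bilinearComp A A

/-- The acceleration `a = - Γ(p, p)` at the point `x` of a geodesic with velocity `p`, in the
preferred chart at `x`. With `G` the metric in this chart, it is the solution of the geodesic
(Euler-Lagrange) equation `G(a, z) = (1/2) (∂_z G)(p, p) - (∂_p G)(p, z)` for all `z`.
On manifolds with boundary the derivative of `G` is taken within the range of the chart. -/
def geodesicAcceleration (g : Metric I M) (x : M) (p : E) : E :=
  let G := metricInChart g x
  let dG : E →L[ℝ] E →L[ℝ] E →L[ℝ] ℝ := fderivWithin ℝ G (Set.range I) (extChartAt I x x)
  (G (extChartAt I x x)).inverse ((1 / 2 : ℝ) • (dG.flip p).flip p - dG p p)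

/-- The geodesic vector field `v^g` on `TM`. In the chart of `TM` induced by the preferred chart
of `M` at the foot point of `w`, whose coordinates are (position, velocity), it is
`(p, - Γ(p, p))` at the velocity `p`; this chart also identifies `T_w(TM)` with `E × E`. -/
def geodesicField (g : Metric I M) (w : TangentBundle I M) : TangentSpace I.tangent w :=
  ((w.snd, geodesicAcceleration g w.proj w.snd) : E × E)

/-- The derivative `dF'(v^g)` at `w` of a function `F'` on `TM`. -/
def derivAlongField (g : Metric I M) (F' : TangentBundle I M → ℝ) (w : TangentBundle I M) : ℝ :=
  (mfderiv I.tangent 𝓘(ℝ, ℝ) F' w : TangentSpace I.tangent w →L[ℝ] ℝ) (geodesicField g w)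

/-- `F` is a smooth function on the submanifold `SM` of `TM`, and `dF(v^g) > 0` on `SM`.
Near every `w ∈ SM` the function `F` is the restriction of a smooth function `F'`, defined on an
open subset of `TM`, and `dF(v^g)` at `w` is computed as `dF'(v^g)`. This does not depend on the
extension, since `v^g` is tangent to `SM`. -/
def IsLyapunov (g : Metric I M) (F : unitTangent g → ℝ) : Prop :=
  ∀ w : unitTangent g, ∃ (U : Set (TangentBundle I M)) (F' : TangentBundle I M → ℝ),
    IsOpen U ∧ (w : TangentBundle I M) ∈ U ∧
    ContMDiffOn I.tangent 𝓘(ℝ, ℝ) ∞ F' U ∧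
    (∀ z : unitTangent g, (z : TangentBundle I M) ∈ U → F' z = F z) ∧
    0 < derivAlongField g F' w

/-- The metric `g` is of the gradient type: there is a smooth `F : SM → ℝ` with `dF(v^g) > 0`. -/
def IsGradientType (g : Metric I M) : Prop :=
  ∃ F : unitTangent g → ℝ, IsLyapunov g F

/-- `γ : J → SM` is an integral curve of the geodesic field, where `J` is a nonempty interval of
any kind (open, semi-open, closed, a single point, bounded or not). The values of `γ` outside `J`
are irrelevant. -/
structure IsFlowCurve (g : Metric I M) (γ : ℝ → TangentBundle I M) (J : Set ℝ) : Prop where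
  nonempty : J.Nonempty
  ordConnected : J.OrdConnected
  mem_unitTangent : ∀ t ∈ J, γ t ∈ unitTangent g
  isMIntegralCurveOn : IsMIntegralCurveOn γ (geodesicField g) J

/-- An integral curve in `SM` which does not extend to an integral curve in `SM` on a larger
interval. -/
def IsMaximalFlowCurve (g : Metric I M) (γ : ℝ → TangentBundle I M) (J : Set ℝ) : Prop :=
  IsFlowCurve g γ J ∧
    ∀ (γ' : ℝ → TangentBundle I M) (J' : Set ℝ),
      IsFlowCurve g γ' J' → J ⊆ J' → Set.EqOn γ γ' J → J' = J

/-- The trajectories of the geodesic flow: the images in `SM` of the maximal integral curves. -/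
def IsTrajectory (g : Metric I M) (T : Set (TangentBundle I M)) : Prop :=
  ∃ (γ : ℝ → TangentBundle I M) (J : Set ℝ), IsMaximalFlowCurve g γ J ∧ T = γ '' J

/-- The `g`-length of the curve `c : J → M`. -/
def curveLength (g : Metric I M) (c : ℝ → M) (J : Set ℝ) : ℝ≥0∞ :=
  ∫⁻ t in J,
    let c' : TangentSpace I (c t) := (mfderiv[J] c t : ℝ →L[ℝ] TangentSpace I (c t)) 1
    ENNReal.ofReal √(g.inner (c t) c' c')

/-- `(M, g)` has a closed geodesic: a trajectory of the geodesic flow is periodic. -/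
def HasClosedGeodesic (g : Metric I M) : Prop :=
  ∃ γ : ℝ → TangentBundle I M, IsFlowCurve g γ Set.univ ∧ ∃ T > 0, Function.Periodic γ T

/-- `(M, g)` has a geodesic of infinite length; geodesics are the projections to `M` of the
integral curves of the geodesic field. -/
def HasInfiniteGeodesic (g : Metric I M) : Prop :=
  ∃ (γ : ℝ → TangentBundle I M) (J : Set ℝ), IsFlowCurve g γ J ∧
    curveLength g (fun t => (γ t).proj) J = ⊤

/-- The metric `g` is non-trapping: no closed geodesics and no geodesics of infinite length. -/
def IsNonTrapping (g : Metric I M) : Prop :=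
  ¬ HasClosedGeodesic g ∧ ¬ HasInfiniteGeodesic g

end GeodesicFlow

end

/-! Both equivalences pass through a third condition: no integral curve of the geodesic field in
`SM` is defined on all of ℝ. Since M may have a boundary, integral curves can stop there. The
argument uses no flow and no uniqueness of integral curves, only compactness of `SM` and continuity
of the field.

Transfer to a vector space. A smooth embedding e of M in Euclidean space gives an injective
immersion (e, de) of `TM`, and the image of the geodesic field on the compact set K = (e, de)(SM)
extends to a bounded uniformly continuous field V on the ambient space (`exists_isFlowEmbedding`).
Integral curves in `SM` correspond to integral curves of V inside K.

No complete curve implies gradient type. An ε-pseudo-orbit stays ε-close to K and has velocity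
ε-close to V. Longer and longer pseudo-orbits with ε → 0 would converge to a complete orbit in K
(`exists_orbit_of_isPseudoOrbit`), so for some ε all durations are bounded. Let F(x) be the supremum
of the durations of those ending at x. Extending a pseudo-orbit by a short segment with velocity
near V(x) shows that F grows at unit rate in every such direction, also near K. This robustness lets
F be mollified: the smooth average still has derivative at least 1 along V on K
(`exists_contDiff_fderiv_pos`).

Gradient type implies no complete curve. A Lyapunov function is increasing and bounded along a
complete curve, hence constant on a limit curve, where it must also increase strictly.

Domains of curves. An unbounded domain yields a complete curve by translating time and passing to
the limit (`exists_complete`). Geodesics have unit speed, so infinite length means an unbounded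
domain. Maximal curves have closed domains, hence compact ones when no complete curve exists, and a
Lyapunov function makes them injective. Conversely, the image of a complete curve is neither a point
nor an arc, because a locally injective curve on ℝ cannot reach an endpoint of an arc. -/

namespace GeodesicFlow

/-! ### Pseudo-orbits of a vector field and their limits -/

section PseudoOrbits

open Set Filter Metric

variable {W : Type*} [NormedAddCommGroup W] [NormedSpace ℝ W]

/-- A curve on `[a, b]` that stays `ε`-close to `K` and whose right derivative is `ε`-close to the
vector field `V`. -/
structure IsPseudoOrbit (V : W → W) (K : Set W) (ε a b : ℝ) (c : ℝ → W) : Prop where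
  continuousOn : ContinuousOn c (Icc a b)
  infDist_le : ∀ t ∈ Icc a b, infDist (c t) K ≤ ε
  exists_deriv : ∀ t ∈ Ico a b, ∃ u, HasDerivWithinAt c u (Ici t) t ∧ ‖u - V (c t)‖ ≤ ε

variable {V : W → W} {K : Set W} {ε ε' a b C : ℝ} {c : ℝ → W}

theorem IsPseudoOrbit.mono (h : IsPseudoOrbit V K ε a b c) (hε : ε ≤ ε') :
    IsPseudoOrbit V K ε' a b c :=
  ⟨h.continuousOn, fun t ht => (h.infDist_le t ht).trans hε, fun t ht =>
    let ⟨u, hu, hu'⟩ := h.exists_deriv t ht; ⟨u, hu, hu'.trans hε⟩⟩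

theorem IsPseudoOrbit.comp_add (h : IsPseudoOrbit V K ε a b c) (τ : ℝ) :
    IsPseudoOrbit V K ε (a - τ) (b - τ) (fun t => c (t + τ)) := by
  refine ⟨h.continuousOn.comp (by fun_prop) fun t ht => ?_, fun t ht => h.infDist_le _ ?_,
    fun t ht => ?_⟩
  · exact ⟨by linarith [ht.1], by linarith [ht.2]⟩
  · exact ⟨by linarith [ht.1], by linarith [ht.2]⟩
  · obtain ⟨u, hu, hu'⟩ := h.exists_deriv (t + τ) ⟨by linarith [ht.1], by linarith [ht.2]⟩
    refine ⟨u, ?_, hu'⟩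
    have h1 : HasDerivWithinAt (fun t : ℝ => t + τ) 1 (Ici t) t :=
      (hasDerivWithinAt_id t _).add_const τ
    have := HasDerivWithinAt.scomp t (h := fun t : ℝ => t + τ) hu h1 (fun x hx => by
      simp only [mem_Ici] at hx ⊢; linarith)
    simpa [Function.comp_def] using this

theorem IsPseudoOrbit.norm_sub_le (h : IsPseudoOrbit V K ε a b c) (hC : ∀ x, ‖V x‖ ≤ C)
    {s t : ℝ} (hs : a ≤ s) (hst : s ≤ t) (ht : t ≤ b) : ‖c t - c s‖ ≤ (C + ε) * (t - s) := by
  have key : ∀ r, ∃ u, r ∈ Ico s t → HasDerivWithinAt c u (Ici r) r ∧ ‖u - V (c r)‖ ≤ ε := by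
    intro r
    by_cases hr : r ∈ Ico s t
    · obtain ⟨u, hu⟩ := h.exists_deriv r ⟨hs.trans hr.1, hr.2.trans_le ht⟩
      exact ⟨u, fun _ => hu⟩
    · exact ⟨0, fun h => absurd h hr⟩
  choose u hu using key
  refine norm_image_sub_le_of_norm_deriv_right_le_segment (f' := u)
    (h.continuousOn.mono (Icc_subset_Icc hs ht)) (fun r hr => (hu r hr).1) (fun r hr => ?_) t
    (right_mem_Icc.2 hst)
  calc ‖u r‖ = ‖V (c r) + (u r - V (c r))‖ := by congr 1; abel
    _ ≤ C + ε := (norm_add_le _ _).trans (add_le_add (hC _) (hu r hr).2)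

theorem IsPseudoOrbit.norm_sub_sub_le_of_le (h : IsPseudoOrbit V K ε a b c)
    (hC : ∀ x, ‖V x‖ ≤ C) {δ η : ℝ} (hη : ∀ x y, ‖x - y‖ ≤ (C + ε) * δ → ‖V x - V y‖ ≤ η)
    (hCε : 0 ≤ C + ε)
    {s t : ℝ} (hs : a ≤ s) (hst : s ≤ t) (ht : t ≤ b) (hδ : t - s ≤ δ) :
    ‖c t - c s - (t - s) • V (c s)‖ ≤ (ε + η) * (t - s) := by
  have key : ∀ r, ∃ u, r ∈ Ico s t → HasDerivWithinAt c u (Ici r) r ∧ ‖u - V (c r)‖ ≤ ε := by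
    intro r
    by_cases hr : r ∈ Ico s t
    · obtain ⟨u, hu⟩ := h.exists_deriv r ⟨hs.trans hr.1, hr.2.trans_le ht⟩
      exact ⟨u, fun _ => hu⟩
    · exact ⟨0, fun h => absurd h hr⟩
  choose u hu using key
  have := norm_image_sub_le_of_norm_deriv_right_le_segment (f := fun r => c r - r • V (c s))
    (f' := fun r => u r - V (c s)) (C := ε + η) (a := s) (b := t)
    ((h.continuousOn.mono (Icc_subset_Icc hs ht)).sub (by fun_prop))
    (fun r hr => by
      have h1 : HasDerivWithinAt (fun r : ℝ => r • V (c s)) (V (c s)) (Ici r) r := by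
        simpa using (hasDerivWithinAt_id r (Ici r)).smul_const (V (c s))
      exact (hu r hr).1.sub h1) (fun r hr => ?_) t
    (right_mem_Icc.2 hst)
  · refine le_trans (le_of_eq ?_) this
    congr 1
    rw [sub_smul]; abel
  · calc ‖u r - V (c s)‖ = ‖(u r - V (c r)) + (V (c r) - V (c s))‖ := by congr 1; abel
      _ ≤ ε + η := (norm_add_le _ _).trans (add_le_add (hu r hr).2 (hη _ _ ?_))
    refine (h.norm_sub_le hC hs hr.1 (hr.2.le.trans ht)).trans ?_
    exact mul_le_mul_of_nonneg_left (by linarith [hr.2]) hCε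

/-- Right derivatives control only forward increments. For t < s the forward estimate is based at t,
and replacing V (c t) by V (c s) costs a second η. -/
theorem IsPseudoOrbit.norm_sub_sub_le (h : IsPseudoOrbit V K ε a b c)
    (hC : ∀ x, ‖V x‖ ≤ C) {δ η : ℝ} (hη : ∀ x y, ‖x - y‖ ≤ (C + ε) * δ → ‖V x - V y‖ ≤ η)
    (hCε : 0 ≤ C + ε) {s t : ℝ} (hs : s ∈ Icc a b) (ht : t ∈ Icc a b) (hδ : |t - s| ≤ δ) :
    ‖c t - c s - (t - s) • V (c s)‖ ≤ (ε + 2 * η) * |t - s| := by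
  have hδ0 : 0 ≤ δ := (abs_nonneg _).trans hδ
  have hη0 : 0 ≤ η := (norm_nonneg _).trans (hη 0 0 (by simpa using mul_nonneg hCε hδ0))
  rcases le_total s t with hst | hst
  · rw [abs_of_nonneg (sub_nonneg.2 hst)] at hδ ⊢
    refine (h.norm_sub_sub_le_of_le hC hη hCε hs.1 hst ht.2 hδ).trans ?_
    exact mul_le_mul_of_nonneg_right (by linarith) (sub_nonneg.2 hst)
  · rw [abs_of_nonpos (sub_nonpos.2 hst), neg_sub] at hδ ⊢
    have h1 := h.norm_sub_sub_le_of_le hC hη hCε ht.1 hst hs.2 hδ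
    have h2 : ‖V (c s) - V (c t)‖ ≤ η :=
      hη _ _ ((h.norm_sub_le hC ht.1 hst hs.2).trans (mul_le_mul_of_nonneg_left hδ hCε))
    calc ‖c t - c s - (t - s) • V (c s)‖
        = ‖-(c s - c t - (s - t) • V (c t)) + (s - t) • (V (c s) - V (c t))‖ := by
          congr 1
          rw [smul_sub, ← neg_sub s t, neg_smul]; abel
      _ ≤ (ε + η) * (s - t) + (s - t) * η := by
          refine (norm_add_le _ _).trans (add_le_add (by rwa [norm_neg]) ?_)
          rw [norm_smul, Real.norm_of_nonneg (sub_nonneg.2 hst)]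
          exact mul_le_mul_of_nonneg_left h2 (sub_nonneg.2 hst)
      _ = _ := by ring

theorem isCompact_infDist_le [FiniteDimensional ℝ W] (hK : IsCompact K) (hne : K.Nonempty)
    (r : ℝ) : IsCompact {x | infDist x K ≤ r} := by
  have : ProperSpace W := FiniteDimensional.proper ℝ W
  obtain ⟨R, hR⟩ := hK.isBounded.subset_closedBall 0
  refine (isCompact_closedBall (0 : W) (R + r)).of_isClosed_subset
    (isClosed_le (continuous_infDist_pt K) continuous_const) fun x hx => ?_
  obtain ⟨y, hy, hxy⟩ := hK.exists_infDist_eq_dist hne x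
  rw [mem_closedBall]
  have h1 := hR hy
  rw [mem_closedBall] at h1
  have : infDist x K ≤ r := hx
  linarith [dist_triangle x y 0]

/-- A sequence of finer and finer pseudo-orbits, on longer and longer time intervals, converges
along any nonprincipal ultrafilter to an orbit in `K` that is defined for all times. -/
theorem exists_orbit_of_isPseudoOrbit [FiniteDimensional ℝ W] (hK : IsCompact K)
    (hne : K.Nonempty) (hV : UniformContinuous V) (hC : ∀ x, ‖V x‖ ≤ C)
    {c : ℕ → ℝ → W} {ε a b : ℕ → ℝ} (hε : Tendsto ε atTop (𝓝 0)) (ha : Tendsto a atTop atBot)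
    (hb : Tendsto b atTop atTop) (h : ∀ m, IsPseudoOrbit V K (ε m) (a m) (b m) (c m))
    (l : Ultrafilter ℕ) (hl : (l : Filter ℕ) ≤ atTop) :
    ∃ γ : ℝ → W, ∀ t, γ t ∈ K ∧ HasDerivAt γ (V (γ t)) t ∧
      Tendsto (fun m => c m t) l (𝓝 (γ t)) := by
  have hab : ∀ t, ∀ᶠ m in (l : Filter ℕ), t ∈ Icc (a m) (b m) := fun t =>
    hl ((ha.eventually_le_atBot t).and (hb.eventually_ge_atTop t))
  have hε1 : ∀ r > 0, ∀ᶠ m in (l : Filter ℕ), ε m < r := fun r hr =>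
    hl (hε.eventually_lt_const hr)
  have hC0 : 0 ≤ C := (norm_nonneg _).trans (hC 0)
  have lim : ∀ t, ∃ y, Tendsto (fun m => c m t) l (𝓝 y) := by
    intro t
    have hmem : ∀ᶠ m in (l : Filter ℕ), c m t ∈ {x | infDist x K ≤ 1} := by
      filter_upwards [hab t, hε1 1 one_pos] with m hm hm'
      exact ((h m).infDist_le t hm).trans hm'.le
    -- The values eventually lie in a compact neighbourhood of K, so the ultrafilter gives limits at
    -- all times at once, with no diagonal subsequence.
    obtain ⟨y, -, hy⟩ := (isCompact_infDist_le hK hne 1).ultrafilter_le_nhds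
      (l.map (fun m => c m t)) (le_principal_iff.2 hmem)
    exact ⟨y, hy⟩
  choose γ hγ using lim
  refine ⟨γ, fun t => ⟨?_, ?_, hγ t⟩⟩
  · rw [← hK.isClosed.closure_eq, mem_closure_iff_infDist_zero hne]
    refine le_antisymm (le_of_forall_gt_imp_ge_of_dense fun r hr => ?_) infDist_nonneg
    refine le_of_tendsto ((continuous_infDist_pt K).continuousAt.tendsto.comp (hγ t)) ?_
    filter_upwards [hab t, hε1 r hr] with m hm hm'
    exact ((h m).infDist_le t hm).trans hm'.le
  · rw [hasDerivAt_iff_isLittleO, Asymptotics.isLittleO_iff]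
    intro κ hκ
    -- With V varying by at most κ / 2 along the short piece, the error rate ε m + 2 (κ / 2) tends
    -- to κ, and the linear approximation passes to the limit.
    obtain ⟨δ₀, hδ₀, hVδ⟩ := Metric.uniformContinuous_iff.1 hV (κ / 2) (half_pos hκ)
    have hδ : 0 < δ₀ / 2 / (C + 1) := by positivity
    filter_upwards [Metric.closedBall_mem_nhds t hδ] with s hs
    rw [mem_closedBall, Real.dist_eq] at hs
    have hη : ∀ r ≤ (1 : ℝ), ∀ x y, ‖x - y‖ ≤ (C + r) * (δ₀ / 2 / (C + 1)) →
        ‖V x - V y‖ ≤ κ / 2 := by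
      intro r hr x y hxy
      rw [← dist_eq_norm]
      refine (hVδ ?_).le
      rw [dist_eq_norm]
      refine hxy.trans_lt ?_
      calc (C + r) * (δ₀ / 2 / (C + 1)) ≤ (C + 1) * (δ₀ / 2 / (C + 1)) :=
            mul_le_mul_of_nonneg_right (by linarith) hδ.le
        _ = δ₀ / 2 := by field_simp
        _ < δ₀ := by linarith
    have hlim : Tendsto (fun m => ‖c m s - c m t - (s - t) • V (c m t)‖) l
        (𝓝 ‖γ s - γ t - (s - t) • V (γ t)‖) :=
      (((hγ s).sub (hγ t)).sub
        ((hV.continuous.continuousAt.tendsto.comp (hγ t)).const_smul (s - t))).norm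
    have hlim' : Tendsto (fun m => (ε m + 2 * (κ / 2)) * |s - t|) l (𝓝 (κ * ‖s - t‖)) := by
      have := ((hε.mono_left hl).add_const (2 * (κ / 2))).mul_const |s - t|
      simpa [mul_div_cancel₀] using this
    refine le_of_tendsto_of_tendsto hlim hlim' ?_
    filter_upwards [hab t, hab s, hε1 1 one_pos] with m hm hm' hm1
    have : 0 ≤ ε m := infDist_nonneg.trans ((h m).infDist_le t hm)
    exact (h m).norm_sub_sub_le hC (hη (ε m) hm1.le) (by positivity) hm hm' hs

end PseudoOrbits

/-! ### A Lyapunov function from the durations of pseudo-orbits -/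

section Lyapunov

open Set Filter Metric

variable {W : Type*} [NormedAddCommGroup W] [NormedSpace ℝ W]

/-- Some `ε'`-pseudo-orbit with `ε' < ε`, of duration `T`, ends at `x`. -/
def IsPseudoOrbitEnd (V : W → W) (K : Set W) (ε T : ℝ) (x : W) : Prop :=
  ∃ ε' < ε, ∃ c : ℝ → W, IsPseudoOrbit V K ε' 0 T c ∧ c T = x

variable {V : W → W} {K : Set W} {ε T C : ℝ} {x : W}

theorem isPseudoOrbitEnd_zero (hx : infDist x K < ε) : IsPseudoOrbitEnd V K ε 0 x :=
  ⟨infDist x K, hx, fun _ => x, ⟨continuousOn_const, fun _ _ => le_rfl,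
    fun t ht => by simp at ht⟩, rfl⟩

/-- The endpoint is moved to y by adding the drift (t / T) (y - c T). The strict inequality ε' < ε
pays for it, and T > 0 keeps its speed small. -/
theorem IsPseudoOrbitEnd.eventually (hV : UniformContinuous V)
    (h : IsPseudoOrbitEnd V K ε T x) (hT : 0 < T) :
    ∀ᶠ y in 𝓝 x, IsPseudoOrbitEnd V K ε T y := by
  obtain ⟨ε', hε', c, hc, rfl⟩ := h
  -- One κ covers the speed of the drift and one the change of V along it; the third keeps the new
  -- tolerance strictly below ε.
  set κ := (ε - ε') / 3 with hκdef
  have hκ : 0 < κ := by rw [hκdef]; linarith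
  obtain ⟨δ, hδ, hVδ⟩ := Metric.uniformContinuous_iff.1 hV κ hκ
  have hr : 0 < min δ (min κ (T * κ)) := by positivity
  filter_upwards [Metric.ball_mem_nhds (c T) hr] with y hy
  rw [mem_ball, dist_eq_norm] at hy
  have hy1 : ‖y - c T‖ < δ := hy.trans_le (min_le_left _ _)
  have hy2 : ‖y - c T‖ < κ := hy.trans_le ((min_le_right _ _).trans (min_le_left _ _))
  have hy3 : ‖y - c T‖ < T * κ := hy.trans_le ((min_le_right _ _).trans (min_le_right _ _))
  have hsmall : ∀ t ∈ Icc 0 T, ‖(t / T) • (y - c T)‖ ≤ ‖y - c T‖ := by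
    intro t ht
    rw [norm_smul, Real.norm_of_nonneg (div_nonneg ht.1 hT.le)]
    exact mul_le_of_le_one_left (norm_nonneg _) ((div_le_one hT).2 ht.2)
  refine ⟨ε' + 2 * κ, by rw [hκdef]; linarith, fun t => c t + (t / T) • (y - c T),
    ⟨hc.continuousOn.add (by fun_prop), fun t ht => ?_, fun t ht => ?_⟩, ?_⟩
  · have h1 := infDist_le_infDist_add_dist (s := K) (x := c t + (t / T) • (y - c T)) (y := c t)
    rw [dist_eq_norm, add_sub_cancel_left] at h1
    linarith [hc.infDist_le t ht, hsmall t ht]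
  · obtain ⟨u, hu, hu'⟩ := hc.exists_deriv t ht
    refine ⟨u + T⁻¹ • (y - c T), hu.add ?_, ?_⟩
    · have h1 : HasDerivWithinAt (fun t : ℝ => t / T) T⁻¹ (Ici t) t := by
        simpa using (hasDerivWithinAt_id t (Ici t)).div_const T
      exact h1.smul_const _
    · have h1 : ‖V (c t) - V (c t + (t / T) • (y - c T))‖ < κ := by
        rw [← dist_eq_norm]
        refine hVδ ?_
        rw [dist_eq_norm, sub_add_cancel_left, norm_neg]
        exact (hsmall t ⟨ht.1, ht.2.le⟩).trans_lt hy1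
      have h2 : ‖T⁻¹ • (y - c T)‖ ≤ κ := by
        rw [norm_smul, Real.norm_of_nonneg (inv_nonneg.2 hT.le), inv_mul_le_iff₀ hT]
        exact hy3.le
      calc _ = ‖(u - V (c t)) + T⁻¹ • (y - c T) + (V (c t) - V (c t + (t / T) • (y - c T)))‖ := by
            congr 1; abel
        _ ≤ ε' + κ + κ := (norm_add_le _ _).trans
            (add_le_add ((norm_add_le _ _).trans (add_le_add hu' h2)) h1.le)
        _ = _ := by ring
  · simp [div_self hT.ne']

/-- The pseudo-orbit is continued by the straight segment with velocity u. Allowing every u near V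
z, and every z near K, is what later makes the growth of the duration survive averaging. -/
theorem exists_isPseudoOrbitEnd_add (hV : UniformContinuous V) (hC : ∀ x, ‖V x‖ ≤ C)
    (hε : 0 < ε) :
    ∃ s₀ > 0, ∀ z u, infDist z K ≤ ε / 2 → ‖u - V z‖ ≤ ε / 2 → ∀ s ∈ Icc 0 s₀, ∀ T ≥ 0,
      IsPseudoOrbitEnd V K ε T z → IsPseudoOrbitEnd V K ε (T + s) (z + s • u) := by
  have hC0 : 0 ≤ C := (norm_nonneg _).trans (hC 0)
  obtain ⟨δ, hδ, hVδ⟩ := Metric.uniformContinuous_iff.1 hV (ε / 4) (by positivity)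
  -- The speed ‖u‖ is at most C + ε, so the segment has length at most min (δ / 2) (ε / 4): both the
  -- distance to K and the velocity error grow from ε / 2 to at most 3 ε / 4.
  have hs₀ : 0 < min (δ / 2) (ε / 4) / (C + ε) := by positivity
  refine ⟨_, hs₀, fun z u hz hu s hs T hT h => ?_⟩
  obtain ⟨ε', hε', c, hc, rfl⟩ := h
  have hu' : ‖u‖ ≤ C + ε := by
    calc ‖u‖ = ‖V (c T) + (u - V (c T))‖ := by congr 1; abel
      _ ≤ C + ε := (norm_add_le _ _).trans (add_le_add (hC _) (hu.trans (by linarith)))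
  have hru : ∀ r ∈ Icc 0 s, ‖r • u‖ ≤ min (δ / 2) (ε / 4) := by
    intro r hr
    rw [norm_smul, Real.norm_of_nonneg hr.1]
    calc r * ‖u‖ ≤ min (δ / 2) (ε / 4) / (C + ε) * (C + ε) :=
          mul_le_mul (hr.2.trans hs.2) hu' (norm_nonneg _) hs₀.le
      _ = _ := by field_simp
  refine ⟨max ε' (3 * ε / 4), max_lt hε' (by linarith),
    fun t => c (min t T) + (max (t - T) 0) • u, ⟨?_, fun t ht => ?_, fun t ht => ?_⟩, ?_⟩
  · refine ContinuousOn.add (hc.continuousOn.comp (by fun_prop) fun t ht => ?_) (by fun_prop)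
    exact ⟨le_min ht.1 hT, min_le_right _ _⟩
  · rcases le_total t T with htT | htT
    · simp only [min_eq_left htT, max_eq_right (sub_nonpos.2 htT), zero_smul, add_zero]
      exact (hc.infDist_le t ⟨ht.1, htT⟩).trans (le_max_left _ _)
    · simp only [min_eq_right htT, max_eq_left (sub_nonneg.2 htT)]
      have h1 := infDist_le_infDist_add_dist (s := K) (x := c T + (t - T) • u) (y := c T)
      rw [dist_eq_norm, add_sub_cancel_left] at h1
      have h2 := (hru (t - T) ⟨by linarith, by linarith [ht.2]⟩).trans (min_le_right _ _)
      refine le_trans ?_ (le_max_right _ _)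
      linarith
  · rcases lt_or_ge t T with htT | htT
    · obtain ⟨v, hv, hv'⟩ := hc.exists_deriv t ⟨ht.1, htT⟩
      refine ⟨v, ?_, ?_⟩
      · refine (hv.congr_of_eventuallyEq ?_ ?_)
        · filter_upwards [nhdsWithin_le_nhds (eventually_lt_nhds htT)] with r hr
          simp [min_eq_left hr.le, max_eq_right (sub_nonpos.2 hr.le)]
        · simp [min_eq_left htT.le, max_eq_right (sub_nonpos.2 htT.le)]
      · simp only [min_eq_left htT.le, max_eq_right (sub_nonpos.2 htT.le), zero_smul, add_zero]
        exact hv'.trans (le_max_left _ _)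
    · refine ⟨u, ?_, ?_⟩
      · have h1 : HasDerivWithinAt (fun r : ℝ => c T + (r - T) • u) u (Ici t) t := by
          simpa using (((hasDerivWithinAt_id t (Ici t)).sub_const T).smul_const u).const_add (c T)
        refine h1.congr (fun r hr => ?_) ?_
        · simp [min_eq_right (htT.trans hr), max_eq_left (sub_nonneg.2 (htT.trans hr))]
        · simp [min_eq_right htT, max_eq_left (sub_nonneg.2 htT)]
      · simp only [min_eq_right htT, max_eq_left (sub_nonneg.2 htT)]
        have h2 := (hru (t - T) ⟨by linarith, by linarith [ht.2]⟩).trans (min_le_left _ _)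
        have h3 : ‖V (c T) - V (c T + (t - T) • u)‖ < ε / 4 := by
          rw [← dist_eq_norm]
          refine hVδ ?_
          rw [dist_eq_norm, sub_add_cancel_left, norm_neg]
          linarith
        refine le_trans ?_ (le_max_right _ _)
        calc _ = ‖(u - V (c T)) + (V (c T) - V (c T + (t - T) • u))‖ := by congr 1; abel
          _ ≤ ε / 2 + ε / 4 := (norm_add_le _ _).trans (add_le_add hu h3.le)
          _ = _ := by ring
  · simp [hs.1]

/-- The supremum of the durations of the `ε`-pseudo-orbits that end at `x`. -/
noncomputable def pseudoOrbitTime (V : W → W) (K : Set W) (ε : ℝ) (x : W) : ℝ :=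
  sSup {T | 0 ≤ T ∧ IsPseudoOrbitEnd V K ε T x}

/-- Each positive duration attained at x is attained at all nearby points. Needed only to make the
function measurable. -/
theorem lowerSemicontinuous_pseudoOrbitTime (hV : UniformContinuous V) {B : ℝ}
    (hB : ∀ T x, IsPseudoOrbitEnd V K ε T x → T ≤ B) (a : ℝ) :
    IsOpen {x | a < pseudoOrbitTime V K ε x} := by
  rw [isOpen_iff_eventually]
  intro x hx
  have hbdd : ∀ y, BddAbove {T | 0 ≤ T ∧ IsPseudoOrbitEnd V K ε T y} :=
    fun y => ⟨B, fun T hT => hB T y hT.2⟩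
  rcases lt_or_ge a 0 with ha | ha
  · exact Eventually.of_forall fun y => ha.trans_le (Real.sSup_nonneg fun T hT => hT.1)
  · have hne : {T | 0 ≤ T ∧ IsPseudoOrbitEnd V K ε T x}.Nonempty := by
      -- The supremum of the empty set is 0 by convention, which is incompatible with 0 ≤ a < sSup.
      by_contra hne
      rw [not_nonempty_iff_eq_empty] at hne
      simp only [mem_ofPred_eq, pseudoOrbitTime, hne, Real.sSup_empty] at hx
      linarith
    obtain ⟨T, hT, haT⟩ := exists_lt_of_lt_csSup hne hx
    filter_upwards [hT.2.eventually hV (ha.trans_lt haT)] with y hy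
    exact haT.trans_le (le_csSup (hbdd y) ⟨hT.1, hy⟩)

/-- Otherwise there are pseudo-orbits with tolerance 1 / (m + 1) and duration greater than 2 m.
Shifting time by half the duration makes both ends of the interval escape to infinity, and the limit
is a complete orbit. -/
theorem exists_isPseudoOrbitEnd_le [FiniteDimensional ℝ W] (hK : IsCompact K) (hne : K.Nonempty)
    (hV : UniformContinuous V) (hC : ∀ x, ‖V x‖ ≤ C)
    (h : ¬ ∃ γ : ℝ → W, ∀ t, γ t ∈ K ∧ HasDerivAt γ (V (γ t)) t) :
    ∃ ε > 0, ∃ B, ∀ T x, IsPseudoOrbitEnd V K ε T x → T ≤ B := by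
  by_contra! hcon
  have key : ∀ m : ℕ, ∃ (T : ℝ) (c : ℝ → W), 2 * (m : ℝ) < T ∧
      IsPseudoOrbit V K (1 / ((m : ℝ) + 1)) 0 T c := by
    intro m
    obtain ⟨T, x, ⟨ε', hε', c, hc, -⟩, hT⟩ := hcon (1 / ((m : ℝ) + 1)) (by positivity) (2 * m)
    exact ⟨T, c, hT, hc.mono hε'.le⟩
  choose T c hT hc using key
  obtain ⟨γ, hγ⟩ := exists_orbit_of_isPseudoOrbit hK hne hV hC
    (c := fun m t => c m (t + T m / 2)) (ε := fun m => 1 / ((m : ℝ) + 1))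
    (a := fun m => 0 - T m / 2) (b := fun m => T m - T m / 2)
    tendsto_one_div_add_atTop_nhds_zero_nat
    (tendsto_atBot_mono (fun m => by simp only [Function.comp]; linarith [hT m])
      (tendsto_neg_atTop_atBot.comp tendsto_natCast_atTop_atTop))
    (tendsto_atTop_mono (fun m => by linarith [hT m]) tendsto_natCast_atTop_atTop)
    (fun m => (hc m).comp_add _) (hyperfilter ℕ) Nat.hyperfilter_le_atTop
  exact h ⟨γ, fun t => ⟨(hγ t).1, (hγ t).2.1⟩⟩

open MeasureTheory in
/-- A vector field without complete orbits in the compact set `K` has a smooth Lyapunov function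
on `K`. -/
theorem exists_contDiff_fderiv_pos [FiniteDimensional ℝ W] (hK : IsCompact K)
    (hV : UniformContinuous V) (hC : ∀ x, ‖V x‖ ≤ C)
    (h : ¬ ∃ γ : ℝ → W, ∀ t, γ t ∈ K ∧ HasDerivAt γ (V (γ t)) t) :
    ∃ F : W → ℝ, ContDiff ℝ ∞ F ∧ ∀ x ∈ K, 0 < fderiv ℝ F x (V x) := by
  rcases K.eq_empty_or_nonempty with rfl | hne
  · exact ⟨0, contDiff_const, by simp⟩
  obtain ⟨ε, hε, B, hB⟩ := exists_isPseudoOrbitEnd_le hK hne hV hC h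
  obtain ⟨s₀, hs₀, hadd⟩ := exists_isPseudoOrbitEnd_add (K := K) hV hC hε
  borelize W
  let μ : Measure W := Measure.addHaar
  set F := pseudoOrbitTime V K ε with hF
  have hbdd : ∀ y, BddAbove {T | 0 ≤ T ∧ IsPseudoOrbitEnd V K ε T y} :=
    fun y => ⟨B, fun T hT => hB T y hT.2⟩
  have hB0 : 0 ≤ B := by
    obtain ⟨x, hx⟩ := hne
    exact hB 0 x (isPseudoOrbitEnd_zero (by rwa [infDist_zero_of_mem hx]))
  have hF0 : ∀ x, 0 ≤ F x := fun x => Real.sSup_nonneg fun T hT => hT.1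
  have hFB : ∀ x, F x ≤ B := fun x => Real.sSup_le (fun T hT => hB T x hT.2) hB0
  have hFm : Measurable F := measurable_of_Ioi fun a =>
    (lowerSemicontinuous_pseudoOrbitTime hV hB a).measurableSet
  have hFadd : ∀ z u, infDist z K ≤ ε / 2 → ‖u - V z‖ ≤ ε / 2 → ∀ s ∈ Icc 0 s₀,
      F z + s ≤ F (z + s • u) := by
    intro z u hz hu s hs
    rw [← le_sub_iff_add_le]
    refine csSup_le ⟨0, le_rfl, isPseudoOrbitEnd_zero (hz.trans_lt (by linarith))⟩ fun T hT => ?_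
    rw [le_sub_iff_add_le]
    exact le_csSup (hbdd _) ⟨add_nonneg hT.1 hs.1, hadd z u hz hu s hs T hT.1 hT.2⟩
  obtain ⟨δ, hδ, hVδ⟩ := Metric.uniformContinuous_iff.1 hV (ε / 2) (by positivity)
  have hr : 0 < min δ (ε / 2) := by positivity
  -- For y in the support, x - y is ε / 2-close to x ∈ K and V x is ε / 2-close to V (x - y), so V x
  -- is an admissible direction at x - y.
  let φ : ContDiffBump (0 : W) := ⟨min δ (ε / 2) / 2, min δ (ε / 2), by positivity, by linarith⟩
  have hFloc : LocallyIntegrable F μ := by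
    refine (locallyIntegrable_const B).mono hFm.aestronglyMeasurable (ae_of_all _ fun x => ?_)
    rw [Real.norm_of_nonneg (hF0 x), Real.norm_of_nonneg hB0]
    exact hFB x
  let G : W → ℝ := fun x => ∫ y, φ.normed μ y * F (x - y) ∂μ
  have hG : ContDiff ℝ ∞ G :=
    φ.hasCompactSupport_normed.contDiff_convolution_left (ContinuousLinearMap.mul ℝ ℝ)
      φ.contDiff_normed hFloc
  have hint : ∀ x, Integrable (fun y => φ.normed μ y * F (x - y)) μ := by
    intro x
    refine φ.integrable_normed.mul_bdd (c := B) (hFm.comp (by fun_prop)).aestronglyMeasurable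
      (ae_of_all _ fun y => ?_)
    rw [Real.norm_of_nonneg (hF0 _)]
    exact hFB _
  -- The growth inequality of F in the fixed direction V x, averaged over the translates x - y.
  have hGadd : ∀ x ∈ K, ∀ s ∈ Icc 0 s₀, G x + s ≤ G (x + s • V x) := by
    intro x hx s hs
    have h1 : G x + s = ∫ y, (φ.normed μ y * F (x - y) + φ.normed μ y * s) ∂μ := by
      rw [integral_add (hint x) (φ.integrable_normed.mul_const s), integral_mul_const,
        φ.integral_normed, one_mul]
    rw [h1]
    refine integral_mono ((hint x).add (φ.integrable_normed.mul_const s)) (hint _) fun y => ?_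
    beta_reduce
    by_cases hy : y ∈ Function.support (φ.normed μ)
    · rw [φ.support_normed_eq, mem_ball_zero_iff] at hy
      have hy1 : ‖y‖ < δ := hy.trans_le (min_le_left _ _)
      have hy2 : ‖y‖ < ε / 2 := hy.trans_le (min_le_right _ _)
      rw [← mul_add]
      refine mul_le_mul_of_nonneg_left ?_ (φ.nonneg_normed y)
      rw [add_sub_right_comm]
      refine hFadd _ _ ?_ ?_ s hs
      · refine (infDist_le_dist_of_mem hx).trans ?_
        rw [dist_eq_norm, sub_sub_cancel_left, norm_neg]
        exact hy2.le
      · rw [← dist_eq_norm]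
        refine (hVδ ?_).le
        rwa [dist_eq_norm, sub_sub_cancel]
    · rw [Function.notMem_support] at hy
      simp [hy]
  refine ⟨G, hG, fun x hx => ?_⟩
  have hd : HasDerivAt (fun s : ℝ => G (x + s • V x)) (fderiv ℝ G x (V x)) 0 := by
    have h1 : HasDerivAt (fun s : ℝ => x + s • V x) (V x) 0 := by
      simpa using ((hasDerivAt_id (0 : ℝ)).smul_const (V x)).const_add x
    have h2 : HasFDerivAt G (fderiv ℝ G x) (x + (0 : ℝ) • V x) := by
      simpa using (hG.differentiable (by simp) x).hasFDerivAt
    exact h2.comp_hasDerivAt (0 : ℝ) h1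
  have hge : 1 ≤ fderiv ℝ G x (V x) := by
    have := (hasDerivWithinAt_iff_tendsto_slope' (by simp)).1 (hd.hasDerivWithinAt (s := Ioi 0))
    refine ge_of_tendsto this ?_
    filter_upwards [Ioc_mem_nhdsGT hs₀] with s hs
    rw [slope_def_field, le_div_iff₀ (by linarith [hs.1])]
    have := hGadd x hx s ⟨hs.1.le, hs.2⟩
    simp only [zero_smul, add_zero]
    linarith
  linarith

end Lyapunov

/-! ### Second derivatives and changes of coordinates -/

section Calculus

open Set Filter

variable {E F G : Type*} [NormedAddCommGroup E] [NormedSpace ℝ E]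
  [NormedAddCommGroup F] [NormedSpace ℝ F] [NormedAddCommGroup G] [NormedSpace ℝ G]

theorem fderivWithin_fderivWithin_comp {s : Set E} {t : Set F} {ψ : E → F} {f : F → G} {y : E}
    (hs : UniqueDiffOn ℝ s) (ht : UniqueDiffOn ℝ t) (hy : y ∈ s) (hψ : ContDiffWithinAt ℝ 2 ψ s y)
    (hf : ContDiffWithinAt ℝ 2 f t (ψ y)) (hst : MapsTo ψ s t) (a b : E) :
    fderivWithin ℝ (fderivWithin ℝ (f ∘ ψ) s) s y a b =
      fderivWithin ℝ (fderivWithin ℝ f t) t (ψ y) (fderivWithin ℝ ψ s y a) (fderivWithin ℝ ψ s y b)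
        + fderivWithin ℝ f t (ψ y) (fderivWithin ℝ (fderivWithin ℝ ψ s) s y a b) := by
  have hψ1 : ∀ᶠ z in 𝓝[s] y, ContDiffWithinAt ℝ 2 ψ s z := by
    have := hψ.eventually (by simp)
    rwa [insert_eq_of_mem hy] at this
  have hf1 : ∀ᶠ z in 𝓝[s] y, ContDiffWithinAt ℝ 2 f t (ψ z) := by
    have := hf.eventually (by simp)
    rw [insert_eq_of_mem (hst hy)] at this
    exact (hψ.continuousWithinAt.tendsto_nhdsWithin hst).eventually this
  have heq : fderivWithin ℝ (f ∘ ψ) s =ᶠ[𝓝[s] y]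
      fun z => (fderivWithin ℝ f t (ψ z)).comp (fderivWithin ℝ ψ s z) := by
    filter_upwards [hψ1, hf1, self_mem_nhdsWithin] with z hz1 hz2 hz
    exact fderivWithin_comp z (hz2.differentiableWithinAt (by simp))
      (hz1.differentiableWithinAt (by simp)) hst (hs z hz)
  have hdf : HasFDerivWithinAt (fderivWithin ℝ f t) (fderivWithin ℝ (fderivWithin ℝ f t) t (ψ y))
      t (ψ y) :=
    ((hf.fderivWithin_right (m := 1) ht (by norm_num) (hst hy)).differentiableWithinAt
      (by simp)).hasFDerivWithinAt
  have hdψ : HasFDerivWithinAt (fderivWithin ℝ ψ s) (fderivWithin ℝ (fderivWithin ℝ ψ s) s y)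
      s y :=
    ((hψ.fderivWithin_right (m := 1) hs (by norm_num) hy).differentiableWithinAt
      (by simp)).hasFDerivWithinAt
  have h1 : HasFDerivWithinAt ψ (fderivWithin ℝ ψ s y) s y :=
    (hψ.differentiableWithinAt (by simp)).hasFDerivWithinAt
  have hdfψ : HasFDerivWithinAt (fun z => fderivWithin ℝ f t (ψ z)) _ s y := hdf.comp y h1 hst
  rw [heq.fderivWithin_eq (heq.self_of_nhdsWithin hy),
    (hdfψ.clm_comp hdψ).fderivWithin (hs y hy)]
  simp [add_comm]

/-- The Koszul-type right-hand side of the geodesic equation: the linear form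
`z ↦ (1/2) (∂_z G)(p, p) - (∂_p G)(p, z)`. -/
noncomputable def geodesicForm (dG : E →L[ℝ] E →L[ℝ] E →L[ℝ] ℝ) (p : E) : E →L[ℝ] ℝ :=
  (1 / 2 : ℝ) • (dG.flip p).flip p - dG p p

theorem geodesicForm_apply (dG : E →L[ℝ] E →L[ℝ] E →L[ℝ] ℝ) (p z : E) :
    geodesicForm dG p z = 1 / 2 * dG z p p - dG p p z := by
  simp [geodesicForm]

theorem fderivWithin_bilinearComp {s : Set E} {t : Set F} {ψ : E → F}
    {g : F → F →L[ℝ] F →L[ℝ] ℝ} {g' : E → E →L[ℝ] E →L[ℝ] ℝ} {y : E}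
    (hs : UniqueDiffOn ℝ s) (hy : y ∈ s) (hψ : ContDiffWithinAt ℝ 2 ψ s y)
    (hg : DifferentiableWithinAt ℝ g t (ψ y)) (hg' : DifferentiableWithinAt ℝ g' s y)
    (hst : MapsTo ψ s t)
    (h : ∀ᶠ z in 𝓝[s] y,
      g' z = (g (ψ z)).bilinearComp (fderivWithin ℝ ψ s z) (fderivWithin ℝ ψ s z)) (v a b : E) :
    fderivWithin ℝ g' s y v a b =
      fderivWithin ℝ g t (ψ y) (fderivWithin ℝ ψ s y v) (fderivWithin ℝ ψ s y a)
        (fderivWithin ℝ ψ s y b)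
      + g (ψ y) (fderivWithin ℝ (fderivWithin ℝ ψ s) s y v a) (fderivWithin ℝ ψ s y b)
      + g (ψ y) (fderivWithin ℝ ψ s y a) (fderivWithin ℝ (fderivWithin ℝ ψ s) s y v b) := by
  have hdψ : HasFDerivWithinAt (fderivWithin ℝ ψ s) (fderivWithin ℝ (fderivWithin ℝ ψ s) s y)
      s y :=
    ((hψ.fderivWithin_right (m := 1) hs (by norm_num) hy).differentiableWithinAt
      (by simp)).hasFDerivWithinAt
  have h1 : HasFDerivWithinAt ψ (fderivWithin ℝ ψ s y) s y :=
    (hψ.differentiableWithinAt (by simp)).hasFDerivWithinAt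
  have hev : (fun z => g' z a b) =ᶠ[𝓝[s] y]
      fun z => g (ψ z) (fderivWithin ℝ ψ s z a) (fderivWithin ℝ ψ s z b) := by
    filter_upwards [h] with z hz
    rw [hz]; rfl
  have hgψ : HasFDerivWithinAt (fun z => g (ψ z))
      ((fderivWithin ℝ g t (ψ y)).comp (fderivWithin ℝ ψ s y)) s y :=
    HasFDerivWithinAt.comp (g := g) y hg.hasFDerivWithinAt h1 hst
  have hR := ((hgψ.clm_apply
    (hdψ.clm_apply (hasFDerivWithinAt_const a y s))).clm_apply
    (hdψ.clm_apply (hasFDerivWithinAt_const b y s)))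
  have hL := ((hg'.hasFDerivWithinAt.clm_apply (hasFDerivWithinAt_const a y s)).clm_apply
    (hasFDerivWithinAt_const b y s))
  have hL' := hR.congr_of_eventuallyEq hev (hev.self_of_nhdsWithin hy)
  have := congrArg (fun L => L v) ((hs y hy).eq hL hL')
  simp only [_root_.add_apply, ContinuousLinearMap.flip_apply,
    ContinuousLinearMap.comp_apply, ContinuousLinearMap.comp_zero, zero_add] at this
  rw [this]
  ring

/-- Transformation law of the acceleration under a change of coordinates `ψ`. -/
theorem bilinear_acceleration_comp {s : Set E} {t : Set F} {ψ : E → F}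
    {g : F → F →L[ℝ] F →L[ℝ] ℝ} {g' : E → E →L[ℝ] E →L[ℝ] ℝ} {y : E}
    (hs : UniqueDiffOn ℝ s) (hy : y ∈ s) (hψ : ContDiffWithinAt ℝ 2 ψ s y)
    (hsymm : IsSymmSndFDerivWithinAt ℝ ψ s y)
    (hgs : ∀ a b, g (ψ y) a b = g (ψ y) b a)
    (hg : DifferentiableWithinAt ℝ g t (ψ y)) (hg' : DifferentiableWithinAt ℝ g' s y)
    (hst : MapsTo ψ s t)
    (h : ∀ᶠ z in 𝓝[s] y,
      g' z = (g (ψ z)).bilinearComp (fderivWithin ℝ ψ s z) (fderivWithin ℝ ψ s z))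
    (hsurj : Function.Surjective (fderivWithin ℝ ψ s y)) {p a : E}
    (ha : g' y a = geodesicForm (fderivWithin ℝ g' s y) p) :
    g (ψ y) (fderivWithin ℝ (fderivWithin ℝ ψ s) s y p p + fderivWithin ℝ ψ s y a) =
      geodesicForm (fderivWithin ℝ g t (ψ y)) (fderivWithin ℝ ψ s y p) := by
  ext z'
  obtain ⟨z, rfl⟩ := hsurj z'
  have h1 := congrArg (fun L => L z) ha
  have h2 := congrArg (fun L => L a z) (h.self_of_nhdsWithin hy)
  simp only [ContinuousLinearMap.bilinearComp_apply] at h2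
  simp only [geodesicForm_apply, fderivWithin_bilinearComp hs hy hψ hg hg' hst h] at h1 ⊢
  -- Differentiating the pulled-back metric produces second derivatives of ψ. By symmetry of D²ψ and
  -- of g all cancel except g (D²ψ(p, p), Dψ z), the inhomogeneous term of the transformation law.
  rw [map_add, _root_.add_apply, ← h2, h1, hsymm p z]
  rw [hgs (fderivWithin ℝ (fderivWithin ℝ ψ s) s y z p)]
  ring

/-- A left inverse P of L makes P ∘ f tangent to the identity at u t, so u and P ∘ f ∘ u differ to
first order in u r - u t. This recovers the velocity of a curve from that of its embedded image. -/
theorem HasDerivWithinAt.of_comp_injective [FiniteDimensional ℝ E] [FiniteDimensional ℝ F]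
    {f : E → F} {L : E →L[ℝ] F} {S : Set E} {u : ℝ → E} {J : Set ℝ} {t : ℝ} {v : E}
    (hf : HasFDerivWithinAt f L S (u t)) (hL : Function.Injective L)
    (hu : ContinuousWithinAt u J t) (huS : ∀ᶠ r in 𝓝[J] t, u r ∈ S)
    (h : HasDerivWithinAt (f ∘ u) (L v) J t) : HasDerivWithinAt u v J t := by
  obtain ⟨P, hP⟩ := (L : E →ₗ[ℝ] F).exists_leftInverse_of_injective (LinearMap.ker_eq_bot.2 hL)
  set P' : F →L[ℝ] E := LinearMap.toContinuousLinearMap P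
  have hPL : ∀ x, P' (L x) = x := fun x => congrArg (fun A : E →ₗ[ℝ] E => A x) hP
  have h1 : HasDerivWithinAt (fun r => P' (f (u r))) v J t := by
    have := P'.hasFDerivAt.comp_hasDerivWithinAt t h
    rwa [hPL] at this
  have h2 : (fun x => P' (f x) - P' (f (u t)) - (x - u t)) =o[𝓝[S] (u t)] fun x => x - u t := by
    have := (P'.hasFDerivAt.comp_hasFDerivWithinAt (u t) hf).isLittleO
    refine this.congr_left fun x => ?_
    simp [hPL]
  have h3 : (fun r => P' (f (u r)) - P' (f (u t)) - (u r - u t)) =o[𝓝[J] t]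
      fun r => u r - u t :=
    h2.comp_tendsto (tendsto_nhdsWithin_iff.2 ⟨hu, huS⟩)
  -- The error must be small relative to r - t, not u r - u t. Half of ‖u r - u t‖ is absorbed in
  -- the left-hand side, which gives a Lipschitz bound at t.
  have h4 : (fun r => u r - u t) =O[𝓝[J] t] fun r => r - t := by
    have h5 : (fun r => P' (f (u r)) - P' (f (u t))) =O[𝓝[J] t] fun r => r - t :=
      h1.hasFDerivWithinAt.isBigO_sub
    refine Asymptotics.IsBigO.trans ?_ h5
    rw [Asymptotics.isBigO_iff]
    refine ⟨2, ?_⟩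
    filter_upwards [h3.bound (half_pos one_pos)] with r hr
    have : ‖u r - u t‖ ≤ ‖P' (f (u r)) - P' (f (u t))‖ +
        ‖P' (f (u r)) - P' (f (u t)) - (u r - u t)‖ := by
      have := norm_sub_le (P' (f (u r)) - P' (f (u t)))
        (P' (f (u r)) - P' (f (u t)) - (u r - u t))
      rwa [sub_sub_cancel] at this
    linarith
  rw [hasDerivWithinAt_iff_isLittleO] at h1 ⊢
  refine (h1.sub (h3.trans_isBigO h4)).congr_left fun r => ?_
  abel

/-- The derivative at `(y, p)` of the map `(z, q) ↦ (h z, dh_z q)`. -/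
noncomputable def liftDeriv (h : E → F) (s : Set E) (y p : E) : E × E →L[ℝ] F × F :=
  (fderivWithin ℝ h s y).prodMap (fderivWithin ℝ h s y) + (ContinuousLinearMap.inr ℝ F F).comp
    (((fderivWithin ℝ (fderivWithin ℝ h s) s y).flip p).comp (ContinuousLinearMap.fst ℝ E E))

theorem liftDeriv_apply (h : E → F) (s : Set E) (y p : E) (v : E × E) :
    liftDeriv h s y p v = (fderivWithin ℝ h s y v.1,
      fderivWithin ℝ (fderivWithin ℝ h s) s y v.1 p + fderivWithin ℝ h s y v.2) := by
  refine Prod.ext ?_ ?_ <;> simp [liftDeriv, add_comm]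

/-- The derivative is block triangular with `fderivWithin ℝ h s y` twice on the diagonal. -/
theorem liftDeriv_injective {h : E → F} {s : Set E} {y : E}
    (hinj : Function.Injective (fderivWithin ℝ h s y)) (p : E) :
    Function.Injective (liftDeriv h s y p) := by
  refine (injective_iff_map_eq_zero _).2 fun v hv => ?_
  rw [liftDeriv_apply, Prod.mk_eq_zero] at hv
  have h1 : v.1 = 0 := hinj (by rw [hv.1, map_zero])
  have h2 := hv.2
  rw [h1, map_zero, _root_.zero_apply, zero_add] at h2
  exact Prod.ext h1 (hinj (by rw [h2]; simp))

theorem hasFDerivWithinAt_lift {h : E → F} {s : Set E} {S : Set (E × E)} {y : E}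
    (hh : ContDiffWithinAt ℝ 2 h s y) (hs : UniqueDiffOn ℝ s) (hy : y ∈ s)
    (hS : MapsTo Prod.fst S s) (p : E) :
    HasFDerivWithinAt (fun z : E × E => (h z.1, fderivWithin ℝ h s z.1 z.2)) (liftDeriv h s y p)
      S (y, p) := by
  have hfst : HasFDerivWithinAt (Prod.fst : E × E → E) (ContinuousLinearMap.fst ℝ E E)
    S (y, p) := hasFDerivWithinAt_fst
  have hsnd : HasFDerivWithinAt (Prod.snd : E × E → E) (ContinuousLinearMap.snd ℝ E E)
    S (y, p) := hasFDerivWithinAt_snd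
  have h1 : HasFDerivWithinAt h (fderivWithin ℝ h s y) s (y, p).1 :=
    (hh.differentiableWithinAt (by simp)).hasFDerivWithinAt
  have h2 : HasFDerivWithinAt (fderivWithin ℝ h s) (fderivWithin ℝ (fderivWithin ℝ h s) s y)
      s (y, p).1 :=
    ((hh.fderivWithin_right (m := 1) hs (by norm_num) hy).differentiableWithinAt
      (by simp)).hasFDerivWithinAt
  have h3 := HasFDerivWithinAt.comp (y, p) h1 hfst hS
  have h4 := (HasFDerivWithinAt.comp (y, p) h2 hfst hS).clm_apply hsnd
  convert! h3.prodMk h4 using 1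
  refine ContinuousLinearMap.ext fun v => ?_
  rw [liftDeriv_apply]
  simp [add_comm]

end Calculus

/-! ### Charts of the tangent bundle and lifts (f, df) -/

section Manifold

open Set Filter Bundle

set_option maxSynthPendingDepth 3

variable {E : Type*} [NormedAddCommGroup E] [NormedSpace ℝ E] {H : Type*} [TopologicalSpace H]
  {I : ModelWithCorners ℝ E H} {M : Type*} [TopologicalSpace M] [ChartedSpace H M]
  [IsManifold I ∞ M] {W : Type*} [NormedAddCommGroup W] [NormedSpace ℝ W]

theorem extChartAt_tangent_apply (w₀ w : TangentBundle I M) :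
    extChartAt I.tangent w₀ w = (extChartAt I w₀.proj w.proj,
      fderivWithin ℝ (extChartAt I w₀.proj ∘ (extChartAt I w.proj).symm) (range I)
        (extChartAt I w.proj w.proj) w.snd) := rfl

theorem extChartAt_tangent_self (w : TangentBundle I M) :
    extChartAt I.tangent w w = (extChartAt I w.proj w.proj, w.snd) := by
  rw [extChartAt_tangent_apply, fderivWithin_extChartAt_comp_extChartAt_symm_range]
  rfl

theorem extChartAt_tangent_symm_apply (w : TangentBundle I M) {z : E × E}
    (hz : z.1 ∈ (extChartAt I w.proj).target) :
    (extChartAt I.tangent w).symm z = ⟨(extChartAt I w.proj).symm z.1,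
      mfderiv[range I] (extChartAt I w.proj).symm z.1 z.2⟩ := by
  have h1 : (extChartAt I.tangent w).symm z = ⟨(extChartAt I w.proj).symm z.1,
      tangentCoordChange I w.proj ((extChartAt I w.proj).symm z.1)
        ((extChartAt I w.proj).symm z.1) z.2⟩ := rfl
  have h2 : (extChartAt I w.proj).symm z.1 ∈ (chartAt H w.proj).source := by
    rw [← extChartAt_source I]
    exact (extChartAt I w.proj).map_target hz
  have h3 := TangentBundle.symmL_trivializationAt (I := I) (x₀ := w.proj) h2
  rw [TangentBundle.symmL_trivializationAt_eq_core h2, (extChartAt I w.proj).right_inv hz] at h3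
  rw [h1, ← h3]
  rfl

/-- The lift `(f, df)` of a function `f` on `M` to the tangent bundle. -/
noncomputable def tangentLift (I : ModelWithCorners ℝ E H) [IsManifold I ∞ M] (f : M → W)
    (w : TangentBundle I M) : W × W :=
  (f w.proj, (mfderiv I 𝓘(ℝ, W) f w.proj : TangentSpace I w.proj →L[ℝ] W) w.snd)

omit [IsManifold I ∞ M] in
theorem mfderiv_eq_fderivWithin {f : M → W} {x : M} (hf : MDifferentiableAt I 𝓘(ℝ, W) f x) :
    (mfderiv I 𝓘(ℝ, W) f x : TangentSpace I x →L[ℝ] W) =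
      fderivWithin ℝ (f ∘ (extChartAt I x).symm) (range I) (extChartAt I x x) := by
  let D : E →L[ℝ] W := mfderiv I 𝓘(ℝ, W) f x
  have h1 : HasFDerivWithinAt (f ∘ (extChartAt I x).symm) D (range I) (extChartAt I x x) :=
    hf.hasMFDerivAt.2
  exact (h1.fderivWithin (I.uniqueDiffOn _ (mem_range_self _))).symm

theorem mfderiv_comp_mfderivWithin_symm {f : M → W} {x : M} {y : E}
    (hy : y ∈ (extChartAt I x).target)
    (hf : MDifferentiableAt I 𝓘(ℝ, W) f ((extChartAt I x).symm y)) (q : E) :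
    (mfderiv I 𝓘(ℝ, W) f ((extChartAt I x).symm y) :
        TangentSpace I ((extChartAt I x).symm y) →L[ℝ] W)
      (mfderiv[range I] (extChartAt I x).symm y q) =
      fderivWithin ℝ (f ∘ (extChartAt I x).symm) (range I) y q := by
  rw [← mfderivWithin_eq_fderivWithin, mfderiv_comp_mfderivWithin y hf
    (mdifferentiableWithinAt_extChartAt_symm hy)
    (I.uniqueMDiffOn y (extChartAt_target_subset_range x hy))]
  rfl

theorem tangentLift_comp_extChartAt_symm {f : M → W} (w : TangentBundle I M) {z : E × E}
    (hz : z.1 ∈ (extChartAt I w.proj).target)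
    (hf : MDifferentiableAt I 𝓘(ℝ, W) f ((extChartAt I w.proj).symm z.1)) :
    tangentLift I f ((extChartAt I.tangent w).symm z) =
      ((f ∘ (extChartAt I w.proj).symm) z.1,
        fderivWithin ℝ (f ∘ (extChartAt I w.proj).symm) (range I) z.1 z.2) := by
  rw [extChartAt_tangent_symm_apply w hz]
  simp only [tangentLift]
  rw [mfderiv_comp_mfderivWithin_symm hz hf]
  rfl

theorem contDiffOn_comp_extChartAt_symm {f : M → W} (hf : ContMDiff I 𝓘(ℝ, W) ∞ f) (x : M) :
    ContDiffOn ℝ ∞ (f ∘ (extChartAt I x).symm) (extChartAt I x).target :=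
  (hf.comp_contMDiffOn (contMDiffOn_extChartAt_symm x)).contDiffOn

omit [IsManifold I ∞ M] in
theorem eventually_mem_target (x : M) :
    ∀ᶠ y in 𝓝[range I] (extChartAt I x x), y ∈ (extChartAt I x).target :=
  extChartAt_target_mem_nhdsWithin x

theorem contDiffWithinAt_comp_extChartAt_symm {f : M → W} (hf : ContMDiff I 𝓘(ℝ, W) ∞ f)
    {x : M} {y : E} (hy : y ∈ (extChartAt I x).target) :
    ContDiffWithinAt ℝ ∞ (f ∘ (extChartAt I x).symm) (range I) y :=
  (contDiffOn_comp_extChartAt_symm hf x y hy).mono_of_mem_nhdsWithin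
    (extChartAt_target_mem_nhdsWithin_of_mem hy)

theorem contMDiff_tangentLift {f : M → W} (hf : ContMDiff I 𝓘(ℝ, W) ∞ f) :
    ContMDiff I.tangent 𝓘(ℝ, W × W) ∞ (tangentLift I f) :=
  (hf.comp (Bundle.contMDiff_proj (TangentSpace I))).prodMk_space
    ((contMDiff_snd_tangentBundle_modelSpace W 𝓘(ℝ, W)).comp
      (hf.contMDiff_tangentMap (m := ∞) le_rfl))

omit [IsManifold I ∞ M] in
theorem mem_range_tangent {z : E × E} : z ∈ range I.tangent ↔ z.1 ∈ range I := by
  constructor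
  · rintro ⟨y, rfl⟩
    exact ⟨y.1, rfl⟩
  · rintro ⟨y, hy⟩
    exact ⟨(y, z.2), Prod.ext hy rfl⟩

theorem hasMFDerivAt_tangentLift {f : M → W} (hf : ContMDiff I 𝓘(ℝ, W) ∞ f)
    (w : TangentBundle I M) :
    HasMFDerivAt I.tangent 𝓘(ℝ, W × W) (tangentLift I f) w
      (liftDeriv (f ∘ (extChartAt I w.proj).symm) (range I) (extChartAt I w.proj w.proj) w.snd) := by
  refine ⟨(contMDiff_tangentLift hf).continuous.continuousAt, ?_⟩
  change HasFDerivWithinAt (tangentLift I f ∘ (extChartAt I.tangent w).symm)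
    (liftDeriv (f ∘ (extChartAt I w.proj).symm) (range I) (extChartAt I w.proj w.proj) w.snd)
      (range I.tangent) (extChartAt I.tangent w w)
  rw [extChartAt_tangent_self]
  have hy := mem_extChartAt_target (I := I) w.proj
  have hfst : MapsTo (Prod.fst : E × E → E) (range I.tangent) (range I) :=
    fun z hz => mem_range_tangent.1 hz
  refine (hasFDerivWithinAt_lift (
    (contDiffWithinAt_comp_extChartAt_symm hf hy).of_le (by norm_cast))
    I.uniqueDiffOn (mem_range_self _) hfst w.snd).congr_of_eventuallyEq ?_ ?_
  · have : ∀ᶠ z : E × E in 𝓝[range I.tangent] (extChartAt I w.proj w.proj, w.snd),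
        z.1 ∈ (extChartAt I w.proj).target :=
      (continuousWithinAt_fst.tendsto_nhdsWithin hfst).eventually (eventually_mem_target w.proj)
    filter_upwards [this] with z hz
    exact tangentLift_comp_extChartAt_symm w hz (hf.mdifferentiableAt (by simp))
  · exact tangentLift_comp_extChartAt_symm w (z := (_, _)) hy (hf.mdifferentiableAt (by simp))

/-! ### The metric in a chart -/

theorem metricInChart_apply (g : Metric I M) (x : M) (y a b : E) :
    metricInChart g x y a b = g.inner ((extChartAt I x).symm y)
      (mfderiv[range I] (extChartAt I x).symm y a) (mfderiv[range I] (extChartAt I x).symm y b) :=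
  rfl

theorem metricInChart_symm (g : Metric I M) (x : M) (y a b : E) :
    metricInChart g x y a b = metricInChart g x y b a := by
  rw [metricInChart_apply, metricInChart_apply]
  exact g.symm _ _ _

theorem injective_mfderivWithin_extChartAt_symm {x : M} {y : E}
    (hy : y ∈ (extChartAt I x).target) :
    Function.Injective (mfderiv[range I] (extChartAt I x).symm y) := by
  intro a b hab
  have h1 := fun a => DFunLike.congr_fun
    (mfderiv_extChartAt_comp_mfderivWithin_extChartAt_symm (I := I) hy) a
  have h2 := congrArg (mfderiv I 𝓘(ℝ, E) (extChartAt I x) ((extChartAt I x).symm y)) hab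
  exact (h1 a).symm.trans (h2.trans (h1 b))

theorem metricInChart_pos (g : Metric I M) {x : M} {y : E} (hy : y ∈ (extChartAt I x).target)
    {a : E} (ha : a ≠ 0) : 0 < metricInChart g x y a a := by
  refine g.pos _ _ fun h => ha ?_
  exact injective_mfderivWithin_extChartAt_symm hy (h.trans (map_zero _).symm)

theorem mem_extChartAt_tangent_target {w : TangentBundle I M} {z : E × E}
    (hz : z.1 ∈ (extChartAt I w.proj).target) : z ∈ (extChartAt I.tangent w).target := by
  rw [extChartAt_target] at hz ⊢
  have h := (TangentBundle.mem_chart_target_iff (I := I) (I.symm z.1, z.2) w).2 hz.1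
  exact ⟨h, mem_range_tangent.2 hz.2⟩

/-- It suffices to treat each coefficient with constant a, b. The vector field y ↦ dφ⁻¹ a is smooth
because it is the inverse chart of `TM` evaluated at (y, a). -/
theorem contDiffOn_metricInChart [FiniteDimensional ℝ E] (g : Metric I M) (x : M) :
    ContDiffOn ℝ ∞ (metricInChart g x) (extChartAt I x).target := by
  refine contDiffOn_clm_apply.2 fun a => contDiffOn_clm_apply.2 fun b => ?_
  have hlift : ∀ a : E, ContMDiffOn 𝓘(ℝ, E) I.tangent ∞ (fun y : E =>
      (⟨(extChartAt I x).symm y, mfderiv[range I] (extChartAt I x).symm y a⟩ : TangentBundle I M))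
      (extChartAt I x).target := by
    intro a
    have h1 := contMDiffOn_extChartAt_symm (I := I.tangent) (n := ∞) (⟨x, 0⟩ : TangentBundle I M)
    have h2 : ContMDiffOn 𝓘(ℝ, E) 𝓘(ℝ, E × E) ∞ (fun y : E => (y, a)) (extChartAt I x).target :=
      contMDiffOn_id.prodMk_space contMDiffOn_const
    refine (h1.comp h2 fun y hy => ?_).congr fun y hy => ?_
    · exact mem_extChartAt_tangent_target hy
    · exact (extChartAt_tangent_symm_apply (⟨x, 0⟩ : TangentBundle I M) (z := (y, a)) hy).symm
  intro y hy
  have : ContMDiffWithinAt 𝓘(ℝ, E) (I.prod 𝓘(ℝ)) ∞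
      (fun y => TotalSpace.mk' ℝ (E := Bundle.Trivial M ℝ) ((extChartAt I x).symm y)
        (metricInChart g x y a b)) (extChartAt I x).target y := by
    apply ContMDiffWithinAt.clm_bundle_apply₂ (F₁ := E) (F₂ := E)
    · exact g.contMDiff.contMDiffAt.comp_contMDiffWithinAt y (contMDiffOn_extChartAt_symm x y hy)
    · exact hlift a y hy
    · exact hlift b y hy
  simp only [contMDiffWithinAt_totalSpace] at this
  exact this.2.contDiffWithinAt

theorem contDiffWithinAt_metricInChart [FiniteDimensional ℝ E] (g : Metric I M) {x : M} {y : E}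
    (hy : y ∈ (extChartAt I x).target) :
    ContDiffWithinAt ℝ ∞ (metricInChart g x) (range I) y :=
  (contDiffOn_metricInChart g x y hy).mono_of_mem_nhdsWithin
    (extChartAt_target_mem_nhdsWithin_of_mem hy)

theorem metricInChart_transition (g : Metric I M) {x x₀ : M} {y : E}
    (hy : y ∈ (extChartAt I x).target)
    (hy' : (extChartAt I x).symm y ∈ (extChartAt I x₀).source) :
    metricInChart g x y =
      (metricInChart g x₀ ((extChartAt I x₀ ∘ (extChartAt I x).symm) y)).bilinearComp
        (fderivWithin ℝ (extChartAt I x₀ ∘ (extChartAt I x).symm) (range I) y)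
        (fderivWithin ℝ (extChartAt I x₀ ∘ (extChartAt I x).symm) (range I) y) := by
  set ψ := extChartAt I x₀ ∘ (extChartAt I x).symm with hψ
  have hyr := extChartAt_target_subset_range x hy
  have hψy : ψ y ∈ (extChartAt I x₀).target := (extChartAt I x₀).map_source hy'
  have hmaps : MapsTo ψ (range I) (range I) := fun z _ => mem_range_self _
  have hψd : MDifferentiableWithinAt 𝓘(ℝ, E) 𝓘(ℝ, E) ψ (range I) y := by
    refine MDifferentiableAt.comp_mdifferentiableWithinAt y (I' := I) ?_
      (mdifferentiableWithinAt_extChartAt_symm hy)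
    exact mdifferentiableAt_extChartAt (by rwa [← extChartAt_source I])
  have heq : (extChartAt I x).symm =ᶠ[𝓝[range I] y] (extChartAt I x₀).symm ∘ ψ := by
    have : ∀ᶠ z in 𝓝[range I] y, (extChartAt I x).symm z ∈ (extChartAt I x₀).source :=
      (mdifferentiableWithinAt_extChartAt_symm hy).continuousWithinAt.eventually
        ((isOpen_extChartAt_source x₀).mem_nhds hy')
    filter_upwards [this] with z hz
    exact ((extChartAt I x₀).left_inv hz).symm
  let A : E →L[ℝ] E := mfderiv[range I] (extChartAt I x).symm y
  let A' : E →L[ℝ] E := mfderiv[range I] (extChartAt I x₀).symm (ψ y)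
  have hA : A = A'.comp (fderivWithin ℝ ψ (range I) y) := by
    have h1 := heq.mfderivWithin_eq_of_mem (I := 𝓘(ℝ, E)) (I' := I) hyr
    have h2 := mfderivWithin_comp y (mdifferentiableWithinAt_extChartAt_symm hψy) hψd hmaps
      (I.uniqueMDiffOn y hyr)
    rw [mfderivWithin_eq_fderivWithin] at h2
    exact h1.trans h2
  have hpt : (extChartAt I x).symm y = (extChartAt I x₀).symm (ψ y) :=
    heq.self_of_nhdsWithin hyr
  let B : M → E →L[ℝ] E →L[ℝ] ℝ := fun m => g.inner m
  have h3 : metricInChart g x y = (B ((extChartAt I x).symm y)).bilinearComp A A := rfl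
  have h4 : metricInChart g x₀ (ψ y) = (B ((extChartAt I x₀).symm (ψ y))).bilinearComp A' A' := rfl
  rw [h3, h4, hpt, hA]
  rfl

theorem isInvertible_of_pos [FiniteDimensional ℝ E] {G : E →L[ℝ] E →L[ℝ] ℝ}
    (hG : ∀ a ≠ 0, 0 < G a a) : G.IsInvertible := by
  have hinj : Function.Injective (G : E →ₗ[ℝ] E →L[ℝ] ℝ) := by
    refine (injective_iff_map_eq_zero _).2 fun a ha => ?_
    by_contra h
    have h1 := hG a h
    have h2 : G a = 0 := ha
    rw [h2] at h1
    simp at h1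
  have hfin : Module.finrank ℝ E = Module.finrank ℝ (E →L[ℝ] ℝ) := by
    rw [← Subspace.dual_finrank_eq (K := ℝ) (V := E)]
    exact (LinearMap.toContinuousLinearMap (𝕜 := ℝ) (E := E) (F' := ℝ)).finrank_eq
  exact ⟨(LinearEquiv.ofInjectiveOfFinrankEq _ hinj hfin).toContinuousLinearEquiv,
    by ext; rfl⟩

/-! ### The geodesic acceleration and the lifted geodesic field -/

/-- The acceleration of a geodesic with position `y` and velocity `p` in the chart at `x`. -/
noncomputable def accelerationInChart (g : Metric I M) (x : M) (y p : E) : E :=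
  (metricInChart g x y).inverse
    (geodesicForm (fderivWithin ℝ (metricInChart g x) (range I) y) p)

theorem metricInChart_acceleration [FiniteDimensional ℝ E] (g : Metric I M) {x : M} {y : E}
    (hy : y ∈ (extChartAt I x).target) (p : E) :
    metricInChart g x y (accelerationInChart g x y p) =
      geodesicForm (fderivWithin ℝ (metricInChart g x) (range I) y) p :=
  (isInvertible_of_pos fun _ ha => metricInChart_pos g hy ha).self_apply_inverse _

theorem contDiffWithinAt_transition {x x₀ : M} {y : E}
    (hy : y ∈ (extChartAt I x).target) (hy' : (extChartAt I x).symm y ∈ (extChartAt I x₀).source) :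
    ContDiffWithinAt ℝ 2 (extChartAt I x₀ ∘ (extChartAt I x).symm) (range I) y := by
  have h : IsManifold I 2 M := inferInstance
  refine contDiffWithinAt_ext_coord_change x₀ x ?_
  rw [PartialEquiv.trans_source]
  exact ⟨hy, hy'⟩

theorem fderivWithin_transition_surjective {x x₀ : M} (hx : x ∈ (extChartAt I x₀).source) :
    Function.Surjective (fderivWithin ℝ (extChartAt I x₀ ∘ (extChartAt I x).symm) (range I)
      (extChartAt I x x)) := by
  have h1 := (isInvertible_mfderiv_extChartAt (I := I) hx).surjective
  have h2 := mfderiv_eq_fderivWithin (I := I) (f := extChartAt I x₀) (x := x)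
    (mdifferentiableAt_extChartAt (by rwa [← extChartAt_source I]))
  rw [← h2]
  exact h1

/-- The geodesic field is defined at each point through the chart preferred there. This law, with
the D²ψ(p, p) of the second-order chain rule, shows that these choices fit together. -/
theorem accelerationInChart_transition [FiniteDimensional ℝ E] (g : Metric I M) {x x₀ : M}
    (hx : x ∈ (extChartAt I x₀).source) (p : E) :
    let ψ := extChartAt I x₀ ∘ (extChartAt I x).symm
    let y := extChartAt I x x
    accelerationInChart g x₀ (extChartAt I x₀ x) (fderivWithin ℝ ψ (range I) y p) =
      fderivWithin ℝ (fderivWithin ℝ ψ (range I)) (range I) y p p +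
        fderivWithin ℝ ψ (range I) y (accelerationInChart g x y p) := by
  intro ψ y
  have hy : y ∈ (extChartAt I x).target := mem_extChartAt_target x
  have hyx : (extChartAt I x).symm y = x := extChartAt_to_inv x
  have hψy : ψ y = extChartAt I x₀ x := congrArg (extChartAt I x₀) hyx
  have hψt : ψ y ∈ (extChartAt I x₀).target := hψy ▸ (extChartAt I x₀).map_source hx
  have hψc : ContDiffWithinAt ℝ 2 ψ (range I) y :=
    contDiffWithinAt_transition hy (by rwa [hyx])
  have hinv := isInvertible_of_pos fun _ ha => metricInChart_pos g hψt ha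
  refine hinv.injective ?_
  rw [← hψy, metricInChart_acceleration g hψt]
  refine (bilinear_acceleration_comp I.uniqueDiffOn (mem_range_self _) hψc ?_
    (metricInChart_symm g x₀ _)
    ((contDiffWithinAt_metricInChart g hψt).differentiableWithinAt (by simp))
    ((contDiffWithinAt_metricInChart g hy).differentiableWithinAt (by simp))
    (fun z _ => mem_range_self _) ?_ (fderivWithin_transition_surjective hx)
    (metricInChart_acceleration g hy p)).symm
  · exact hψc.isSymmSndFDerivWithinAt (by simp) I.uniqueDiffOn
      (I.range_subset_closure_interior (mem_range_self _)) (mem_range_self _)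
  · have hcont : ∀ᶠ z in 𝓝[range I] y, (extChartAt I x).symm z ∈ (extChartAt I x₀).source :=
      (mdifferentiableWithinAt_extChartAt_symm hy).continuousWithinAt.eventually
        ((isOpen_extChartAt_source x₀).mem_nhds (by rwa [hyx]))
    filter_upwards [hcont, eventually_mem_target x] with z hz hz'
    exact metricInChart_transition g hz' hz

theorem continuousWithinAt_accelerationInChart [FiniteDimensional ℝ E] (g : Metric I M) {x : M} {z : E × E}
    (hz : z.1 ∈ (extChartAt I x).target) :
    ContinuousWithinAt (fun z : E × E => accelerationInChart g x z.1 z.2) (range I.tangent) z := by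
  have hfst : MapsTo (Prod.fst : E × E → E) (range I.tangent) (range I) :=
    fun z hz => mem_range_tangent.1 hz
  have hG := contDiffWithinAt_metricInChart g hz
  have h1 : ContinuousWithinAt (fun z : E × E => metricInChart g x z.1) (range I.tangent) z :=
    hG.continuousWithinAt.comp continuousWithinAt_fst hfst
  have h2 : ContinuousWithinAt
      (fun z : E × E => fderivWithin ℝ (metricInChart g x) (range I) z.1) (range I.tangent) z :=
    (hG.fderivWithin_right (m := 0) I.uniqueDiffOn (by simp)
      (extChartAt_target_subset_range x hz)).continuousWithinAt.comp
      continuousWithinAt_fst hfst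
  have h3 : ContinuousWithinAt (fun z : E × E => (metricInChart g x z.1).inverse)
      (range I.tangent) z :=
    ContinuousAt.comp_continuousWithinAt (f := fun z : E × E => metricInChart g x z.1)
      ((isInvertible_of_pos fun _ ha => metricInChart_pos g hz ha).contDiffAt_map_inverse
        (n := 0)).continuousAt h1
  have hsnd : ContinuousWithinAt (fun z : E × E => z.2) (range I.tangent) z :=
    continuousWithinAt_snd
  refine h3.clm_apply ?_
  have hflip : ContinuousWithinAt (fun z : E × E =>
      ((fderivWithin ℝ (metricInChart g x) (range I) z.1).flip z.2).flip z.2)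
      (range I.tangent) z := by
    have h4 : ContinuousWithinAt (fun z : E × E =>
      (fderivWithin ℝ (metricInChart g x) (range I) z.1).flip) (range I.tangent) z :=
      (ContinuousLinearMap.flipₗᵢ ℝ E E (E →L[ℝ] ℝ)).continuous.continuousAt.comp_continuousWithinAt h2
    have h5 := h4.clm_apply hsnd
    exact ((ContinuousLinearMap.flipₗᵢ ℝ E E ℝ).continuous.continuousAt.comp_continuousWithinAt
      h5).clm_apply hsnd
  exact (hflip.const_smul (1 / 2 : ℝ)).sub ((h2.clm_apply hsnd).clm_apply hsnd)

/-- The image of the geodesic field under the lift `(f, df)` of a function `f` on `M`. -/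
noncomputable def liftedField (g : Metric I M) (f : M → W) (w : TangentBundle I M) : W × W :=
  liftDeriv (f ∘ (extChartAt I w.proj).symm) (range I) (extChartAt I w.proj w.proj) w.snd
    (geodesicField g w : E × E)

/-- Expresses the field near w₀ in one fixed chart, where continuity is visible. The D²ψ(p, p) from
the acceleration matches the one from the second derivative of f ∘ φ₀⁻¹ ∘ ψ. -/
theorem liftedField_eq [FiniteDimensional ℝ E] (g : Metric I M) {f : M → W} (hf : ContMDiff I 𝓘(ℝ, W) ∞ f)
    {w₀ w : TangentBundle I M} (hw : w.proj ∈ (extChartAt I w₀.proj).source) :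
    liftedField g f w =
      (fun z : E × E => liftDeriv (f ∘ (extChartAt I w₀.proj).symm) (range I) z.1 z.2
        (z.2, accelerationInChart g w₀.proj z.1 z.2)) (extChartAt I.tangent w₀ w) := by
  set x := w.proj
  set x₀ := w₀.proj
  set ψ := extChartAt I x₀ ∘ (extChartAt I x).symm
  set y := extChartAt I x x
  have hy : y ∈ (extChartAt I x).target := mem_extChartAt_target x
  have hyx : (extChartAt I x).symm y = x := extChartAt_to_inv x
  have hψy : ψ y = extChartAt I x₀ x := congrArg (extChartAt I x₀) hyx
  have hψt : ψ y ∈ (extChartAt I x₀).target := hψy ▸ (extChartAt I x₀).map_source hw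
  have hψc : ContDiffWithinAt ℝ 2 ψ (range I) y :=
    contDiffWithinAt_transition hy (by rwa [hyx])
  have hfc : ContDiffWithinAt ℝ 2 (f ∘ (extChartAt I x₀).symm) (range I) (ψ y) :=
    (contDiffWithinAt_comp_extChartAt_symm hf hψt).of_le (by norm_cast)
  have heq : f ∘ (extChartAt I x).symm =ᶠ[𝓝[range I] y] (f ∘ (extChartAt I x₀).symm) ∘ ψ := by
    have hcont : ∀ᶠ z in 𝓝[range I] y, (extChartAt I x).symm z ∈ (extChartAt I x₀).source :=
      (mdifferentiableWithinAt_extChartAt_symm hy).continuousWithinAt.eventually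
        ((isOpen_extChartAt_source x₀).mem_nhds (by rwa [hyx]))
    filter_upwards [hcont] with z hz
    exact congrArg f ((extChartAt I x₀).left_inv hz).symm
  have hyr : y ∈ range I := mem_range_self _
  have hmaps : MapsTo ψ (range I) (range I) := fun z _ => mem_range_self _
  have hD : fderivWithin ℝ (f ∘ (extChartAt I x).symm) (range I) y =
      (fderivWithin ℝ (f ∘ (extChartAt I x₀).symm) (range I) (ψ y)).comp
        (fderivWithin ℝ ψ (range I) y) :=
    (heq.fderivWithin_eq_of_mem hyr).trans (fderivWithin_comp y
      (hfc.differentiableWithinAt (by simp)) (hψc.differentiableWithinAt (by simp)) hmaps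
      (I.uniqueDiffOn y hyr))
  have hD2 : fderivWithin ℝ (fderivWithin ℝ (f ∘ (extChartAt I x).symm) (range I)) (range I) y =
      fderivWithin ℝ (fderivWithin ℝ ((f ∘ (extChartAt I x₀).symm) ∘ ψ) (range I)) (range I) y :=
    (heq.fderivWithin' subset_rfl).fderivWithin_eq_of_mem hyr
  let p : E := w.snd
  have hD2' := fderivWithin_fderivWithin_comp I.uniqueDiffOn I.uniqueDiffOn hyr hψc hfc hmaps p p
  have hext : extChartAt I.tangent w₀ w = (ψ y, fderivWithin ℝ ψ (range I) y p) := by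
    rw [hψy]; rfl
  have hacc : accelerationInChart g x₀ (ψ y) (fderivWithin ℝ ψ (range I) y p) =
      fderivWithin ℝ (fderivWithin ℝ ψ (range I)) (range I) y p p +
        fderivWithin ℝ ψ (range I) y (accelerationInChart g x y p) := by
    rw [hψy]; exact accelerationInChart_transition g hw p
  have hL : liftedField g f w = (fderivWithin ℝ (f ∘ (extChartAt I x).symm) (range I) y p,
      fderivWithin ℝ (fderivWithin ℝ (f ∘ (extChartAt I x).symm) (range I)) (range I) y p p +
      fderivWithin ℝ (f ∘ (extChartAt I x).symm) (range I) y (accelerationInChart g x y p)) :=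
    liftDeriv_apply _ _ _ _ _
  rw [hext, hL, hD, hD2, hD2']
  simp only [liftDeriv_apply, hacc, map_add, add_assoc]
  rfl

theorem continuous_liftedField [FiniteDimensional ℝ E] (g : Metric I M) {f : M → W}
    (hf : ContMDiff I 𝓘(ℝ, W) ∞ f) : Continuous (liftedField g f) := by
  rw [continuous_iff_continuousAt]
  intro w₀
  have hsrc : ∀ᶠ w : TangentBundle I M in 𝓝 w₀, w.proj ∈ (extChartAt I w₀.proj).source :=
    (FiberBundle.continuous_proj E (TangentSpace I)).continuousAt.eventually
      (extChartAt_source_mem_nhds w₀.proj)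
  have heq : liftedField g f =ᶠ[𝓝 w₀] (fun z : E × E =>
      liftDeriv (f ∘ (extChartAt I w₀.proj).symm) (range I) z.1 z.2
        (z.2, accelerationInChart g w₀.proj z.1 z.2)) ∘ extChartAt I.tangent w₀ := by
    filter_upwards [hsrc] with w hw
    exact liftedField_eq g hf hw
  refine ContinuousAt.congr ?_ heq.symm
  have hchart : Tendsto (extChartAt I.tangent w₀) (𝓝 w₀)
      (𝓝[range I.tangent] (extChartAt I.tangent w₀ w₀)) :=
    tendsto_nhdsWithin_iff.2 ⟨continuousAt_extChartAt w₀,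
      Eventually.of_forall fun w => mem_range_self _⟩
  refine Tendsto.comp (y := 𝓝[range I.tangent] (extChartAt I.tangent w₀ w₀)) ?_ hchart
  have hz : (extChartAt I.tangent w₀ w₀).1 ∈ (extChartAt I w₀.proj).target :=
    mem_extChartAt_target w₀.proj
  have hzr := extChartAt_target_subset_range _ hz
  set z₀ : E × E := extChartAt I.tangent w₀ w₀
  have hfst : MapsTo (Prod.fst : E × E → E) (range I.tangent) (range I) :=
    fun z hz => mem_range_tangent.1 hz
  have hsnd : ContinuousWithinAt (fun z : E × E => z.2) (range I.tangent) z₀ :=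
    continuousWithinAt_snd
  have hF := contDiffWithinAt_comp_extChartAt_symm hf hz
  have h1 := hF.fderivWithin_right (m := 1) I.uniqueDiffOn (by norm_cast) hzr
  have h2 := h1.fderivWithin_right (m := 0) I.uniqueDiffOn (by simp) hzr
  have h3 := h1.continuousWithinAt.comp (f := Prod.fst) (x := z₀) continuousWithinAt_fst hfst
  have h4 := h2.continuousWithinAt.comp (f := Prod.fst) (x := z₀) continuousWithinAt_fst hfst
  simp only [liftDeriv_apply]
  exact (h3.clm_apply hsnd).prodMk (((h4.clm_apply hsnd).clm_apply hsnd).add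
    (h3.clm_apply (continuousWithinAt_accelerationInChart g hz)))

/-! ### Compactness of the unit tangent bundle -/

theorem metricInChart_extChartAt_tangent (g : Metric I M) {w₀ w : TangentBundle I M}
    (hw : w.proj ∈ (extChartAt I w₀.proj).source) :
    metricInChart g w₀.proj (extChartAt I.tangent w₀ w).1 (extChartAt I.tangent w₀ w).2
      (extChartAt I.tangent w₀ w).2 = g.inner w.proj w.snd w.snd := by
  let Q : TangentBundle I M → ℝ := fun w => g.inner w.proj w.snd w.snd
  have hsrc : w ∈ (extChartAt I.tangent w₀).source := by
    rw [extChartAt_source] at hw ⊢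
    exact (TangentBundle.mem_chart_source_iff w w₀).2 hw
  have h1 : Q ((extChartAt I.tangent w₀).symm (extChartAt I.tangent w₀ w)) = Q w :=
    congrArg Q ((extChartAt I.tangent w₀).left_inv hsrc)
  rw [extChartAt_tangent_symm_apply w₀ ((extChartAt I w₀.proj).map_source hw :)] at h1
  exact h1

theorem eventually_mem_source (w₀ : TangentBundle I M) :
    ∀ᶠ w : TangentBundle I M in 𝓝 w₀, w.proj ∈ (extChartAt I w₀.proj).source :=
  (FiberBundle.continuous_proj E (TangentSpace I)).continuousAt.eventually
    (extChartAt_source_mem_nhds w₀.proj)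

theorem tendsto_extChartAt_tangent (w₀ : TangentBundle I M) :
    Tendsto (extChartAt I.tangent w₀) (𝓝 w₀)
      (𝓝[range I.tangent] (extChartAt I.tangent w₀ w₀)) :=
  tendsto_nhdsWithin_iff.2 ⟨continuousAt_extChartAt w₀,
    Eventually.of_forall fun _ => mem_range_self _⟩

theorem isClosed_unitTangent [FiniteDimensional ℝ E] (g : Metric I M) :
    IsClosed (unitTangent g) := by
  refine isClosed_eq ?_ continuous_const
  rw [continuous_iff_continuousAt]
  intro w₀
  have heq : (fun z : E × E => metricInChart g w₀.proj z.1 z.2 z.2) ∘ extChartAt I.tangent w₀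
      =ᶠ[𝓝 w₀] fun w : TangentBundle I M => g.inner w.proj w.snd w.snd := by
    filter_upwards [eventually_mem_source w₀] with w hw
    exact metricInChart_extChartAt_tangent g hw
  refine ContinuousAt.congr ?_ heq
  refine Tendsto.comp (y := 𝓝[range I.tangent] (extChartAt I.tangent w₀ w₀)) ?_
    (tendsto_extChartAt_tangent w₀)
  have hz : (extChartAt I.tangent w₀ w₀).1 ∈ (extChartAt I w₀.proj).target :=
    mem_extChartAt_target w₀.proj
  set z₀ : E × E := extChartAt I.tangent w₀ w₀
  have h1 : ContinuousWithinAt (fun z : E × E => metricInChart g w₀.proj z.1) (range I.tangent) z₀ :=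
    (contDiffWithinAt_metricInChart g hz).continuousWithinAt.comp continuousWithinAt_fst
      (fun z hz => mem_range_tangent.1 hz)
  have hsnd : ContinuousWithinAt (fun z : E × E => z.2) (range I.tangent) z₀ :=
    continuousWithinAt_snd
  exact (h1.clm_apply hsnd).clm_apply hsnd

/-- Positivity on the compact unit sphere gives a bound a at the centre of the chart, and continuity
of the metric keeps a / 2 nearby. It bounds the velocity coordinates of unit vectors. -/
theorem exists_metricInChart_ge [FiniteDimensional ℝ E] (g : Metric I M) (x : M) :
    ∃ c > 0, ∀ᶠ y in 𝓝[range I] (extChartAt I x x), ∀ p,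
      c * ‖p‖ ^ 2 ≤ metricInChart g x y p p := by
  have : ProperSpace E := FiniteDimensional.proper ℝ E
  set y₀ := extChartAt I x x
  have hy₀ : y₀ ∈ (extChartAt I x).target := mem_extChartAt_target x
  obtain ⟨a, ha, hG⟩ := (isCompact_sphere (0 : E) 1).exists_forall_le'
    (f := fun p => metricInChart g x y₀ p p) (a := 0)
    (((metricInChart g x y₀).continuous.clm_apply continuous_id).continuousOn)
    (fun p hp => metricInChart_pos g hy₀ (ne_zero_of_mem_unit_sphere ⟨p, hp⟩))
  have hG' : ∀ p, a * ‖p‖ ^ 2 ≤ metricInChart g x y₀ p p := by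
    intro p
    rcases eq_or_ne p 0 with rfl | hp
    · simp
    have hp' : 0 < ‖p‖ := norm_pos_iff.2 hp
    have h1 := hG (‖p‖⁻¹ • p) (by simp [norm_smul, hp'.ne'])
    simp only [map_smul, _root_.smul_apply, smul_eq_mul] at h1
    calc a * ‖p‖ ^ 2 ≤ (‖p‖⁻¹ * (‖p‖⁻¹ * metricInChart g x y₀ p p)) * ‖p‖ ^ 2 := by gcongr
      _ = _ := by field_simp
  refine ⟨a / 2, half_pos ha, ?_⟩
  have hc := (contDiffWithinAt_metricInChart g hy₀).continuousWithinAt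
  filter_upwards [hc.eventually (Metric.closedBall_mem_nhds _ (half_pos ha))] with y hy p
  rw [dist_eq_norm] at hy
  have h1 : |(metricInChart g x y - metricInChart g x y₀) p p| ≤ a / 2 * ‖p‖ * ‖p‖ := by
    refine (ContinuousLinearMap.le_opNorm₂ (metricInChart g x y - metricInChart g x y₀) p p).trans ?_
    gcongr
  have h2 := (abs_le.1 h1).1
  simp only [_root_.sub_apply] at h2
  nlinarith [hG' p]

/-- Along an ultrafilter on `SM` the foot points converge since M is compact. In the chart at their
limit the velocities are bounded, hence converge too, and closedness keeps the limit in `SM`. -/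
theorem isCompact_unitTangent [FiniteDimensional ℝ E] [CompactSpace M] (g : Metric I M) :
    IsCompact (unitTangent g) := by
  have : ProperSpace E := FiniteDimensional.proper ℝ E
  rw [isCompact_iff_ultrafilter_le_nhds]
  intro l hl
  obtain ⟨x, -, hx⟩ := isCompact_univ.ultrafilter_le_nhds
    (l.map (fun w : TangentBundle I M => w.proj)) (by simp)
  let w₀ : TangentBundle I M := ⟨x, 0⟩
  have hx' : Tendsto (fun w : TangentBundle I M => w.proj) l (𝓝 x) := hx
  have hsrc : ∀ᶠ w in (l : Filter (TangentBundle I M)), w.proj ∈ (extChartAt I w₀.proj).source :=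
    hx'.eventually (extChartAt_source_mem_nhds x)
  have h1 : Tendsto (fun w : TangentBundle I M => (extChartAt I.tangent w₀ w).1) l
      (𝓝[range I] (extChartAt I x x)) :=
    Tendsto.comp (y := 𝓝 x) (g := extChartAt I x) (tendsto_nhdsWithin_iff.2
      ⟨continuousAt_extChartAt x, Eventually.of_forall fun m => ⟨chartAt H x m, rfl⟩⟩) hx'
  obtain ⟨c, hc, hG⟩ := exists_metricInChart_ge g x
  have h2 : ∀ᶠ w in (l : Filter (TangentBundle I M)),
      (extChartAt I.tangent w₀ w).2 ∈ Metric.closedBall (0 : E) √(1 / c) := by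
    filter_upwards [h1.eventually hG, hsrc, le_principal_iff.1 hl] with w hw hw1 hw2
    have h3 := hw (extChartAt I.tangent w₀ w).2
    have h4 : g.inner w.proj w.snd w.snd = 1 := hw2
    have h5 := metricInChart_extChartAt_tangent g hw1
    rw [h4] at h5
    rw [mem_closedBall_zero_iff]
    refine Real.le_sqrt_of_sq_le ?_
    rw [le_div_iff₀ hc, mul_comm]
    exact h3.trans_eq h5
  obtain ⟨p, -, hp⟩ := (isCompact_closedBall (0 : E) √(1 / c)).ultrafilter_le_nhds
    (l.map fun w : TangentBundle I M => (extChartAt I.tangent w₀ w).2) (le_principal_iff.2 h2)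
  have hp' : Tendsto (fun w : TangentBundle I M => (extChartAt I.tangent w₀ w).2) l (𝓝 p) := hp
  have ht : (extChartAt I x x, p) ∈ (extChartAt I.tangent w₀).target :=
    mem_extChartAt_tangent_target (z := (extChartAt I x x, p)) (mem_extChartAt_target x)
  have h3 : Tendsto (fun w => extChartAt I.tangent w₀ w) l (𝓝 (extChartAt I x x, p)) :=
    (tendsto_nhds_of_tendsto_nhdsWithin h1).prodMk_nhds hp'
  have h4 : Tendsto (fun w => (extChartAt I.tangent w₀).symm (extChartAt I.tangent w₀ w)) l
      (𝓝 ((extChartAt I.tangent w₀).symm (extChartAt I x x, p))) := by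
    refine ((continuousOn_extChartAt_symm w₀) _ ht).tendsto.comp (tendsto_nhdsWithin_iff.2 ⟨h3, ?_⟩)
    filter_upwards [hsrc] with w hw
    exact mem_extChartAt_tangent_target ((extChartAt I x).map_source hw)
  have h5 : Tendsto id l (𝓝 ((extChartAt I.tangent w₀).symm (extChartAt I x x, p))) := by
    refine h4.congr' ?_
    filter_upwards [hsrc] with w hw
    refine (extChartAt I.tangent w₀).left_inv ?_
    rw [extChartAt_source] at hw ⊢
    exact (TangentBundle.mem_chart_source_iff w w₀).2 hw
  exact ⟨_, (isClosed_unitTangent g).mem_of_tendsto h5 (le_principal_iff.1 hl), h5⟩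

/-! ### Integral curves under the lift, and their length -/

theorem hasDerivWithinAt_tangentLift (g : Metric I M) {f : M → W} (hf : ContMDiff I 𝓘(ℝ, W) ∞ f)
    {γ : ℝ → TangentBundle I M} {J : Set ℝ} {t : ℝ}
    (h : HasMFDerivWithinAt 𝓘(ℝ, ℝ) I.tangent γ J t
      ((1 : ℝ →L[ℝ] ℝ).smulRight (geodesicField g (γ t)))) :
    HasDerivWithinAt (fun s => tangentLift I f (γ s)) (liftedField g f (γ t)) J t := by
  let a : E × E := geodesicField g (γ t)
  have h1 : HasFDerivWithinAt (fun s => tangentLift I f (γ s))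
      ((liftDeriv (f ∘ (extChartAt I (γ t).proj).symm) (range I)
        (extChartAt I (γ t).proj (γ t).proj) (γ t).snd).comp ((1 : ℝ →L[ℝ] ℝ).smulRight a)) J t :=
    ((hasMFDerivAt_tangentLift hf (γ t)).comp_hasMFDerivWithinAt t h).hasFDerivWithinAt
  refine h1.hasDerivWithinAt.congr_deriv ?_
  rw [ContinuousLinearMap.comp_apply, ContinuousLinearMap.smulRight_apply,
    one_apply_eq_self, one_smul]
  rfl

omit [IsManifold I ∞ M] in
theorem liftDeriv_injective_of_mfderiv {f : M → W} (hf : ContMDiff I 𝓘(ℝ, W) ∞ f) {x : M}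
    (hinj : Function.Injective (mfderiv I 𝓘(ℝ, W) f x)) (p : E) :
    Function.Injective (liftDeriv (f ∘ (extChartAt I x).symm) (range I) (extChartAt I x x) p) := by
  refine liftDeriv_injective ?_ p
  rw [← mfderiv_eq_fderivWithin (hf.mdifferentiableAt (by simp))]
  exact hinj

theorem hasMFDerivWithinAt_of_tangentLift [FiniteDimensional ℝ E] [FiniteDimensional ℝ W]
    (g : Metric I M) {f : M → W}
    (hf : ContMDiff I 𝓘(ℝ, W) ∞ f) (hinj : ∀ x, Function.Injective (mfderiv I 𝓘(ℝ, W) f x))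
    {γ : ℝ → TangentBundle I M} {J : Set ℝ} {t : ℝ} (hγ : ContinuousWithinAt γ J t)
    (h : HasDerivWithinAt (fun s => tangentLift I f (γ s)) (liftedField g f (γ t)) J t) :
    HasMFDerivWithinAt 𝓘(ℝ, ℝ) I.tangent γ J t
      ((1 : ℝ →L[ℝ] ℝ).smulRight (geodesicField g (γ t))) := by
  refine ⟨hγ, ?_⟩
  let a : E × E := geodesicField g (γ t)
  have h1 := (hasMFDerivAt_tangentLift hf (γ t)).2
  have h2 : HasFDerivWithinAt (tangentLift I f ∘ (extChartAt I.tangent (γ t)).symm)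
      (liftDeriv (f ∘ (extChartAt I (γ t).proj).symm) (range I)
        (extChartAt I (γ t).proj (γ t).proj) (γ t).snd) (range I.tangent)
        ((extChartAt I.tangent (γ t) ∘ γ) t) := h1
  have hsrc : ∀ᶠ s in 𝓝[J] t, γ s ∈ (extChartAt I.tangent (γ t)).source :=
    hγ.eventually (extChartAt_source_mem_nhds (γ t))
  have key : HasDerivWithinAt (extChartAt I.tangent (γ t) ∘ γ) a J t := by
    refine HasDerivWithinAt.of_comp_injective h2 (liftDeriv_injective_of_mfderiv hf (hinj _) _)
      ((continuousAt_extChartAt (γ t)).comp_continuousWithinAt hγ)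
      (Eventually.of_forall fun s => ⟨chartAt _ (γ t) (γ s), rfl⟩) ?_
    refine h.congr_of_eventuallyEq ?_ ?_
    · filter_upwards [hsrc] with s hs
      exact congrArg (tangentLift I f) ((extChartAt I.tangent (γ t)).left_inv hs)
    · exact congrArg (tangentLift I f) (extChartAt_to_inv (γ t))
  have h3 := key.hasFDerivWithinAt
  simp only [mfld_simps]
  convert! h3 using 1

theorem hasMFDerivAt_proj (w : TangentBundle I M) :
    HasMFDerivAt I.tangent I (fun w : TangentBundle I M => w.proj) w
      (ContinuousLinearMap.fst ℝ E E) := by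
  refine ⟨(FiberBundle.continuous_proj E (TangentSpace I)).continuousAt, ?_⟩
  have h1 : HasFDerivWithinAt (Prod.fst : E × E → E) (ContinuousLinearMap.fst ℝ E E)
    (range I.tangent) (extChartAt I.tangent w w) := hasFDerivWithinAt_fst
  have hev : ∀ᶠ z : E × E in 𝓝[range I.tangent] (extChartAt I.tangent w w),
      z ∈ (extChartAt I.tangent w).target := extChartAt_target_mem_nhdsWithin w
  have h2 : ∀ z ∈ (extChartAt I.tangent w).target, (extChartAt I w.proj)
      ((extChartAt I.tangent w).symm z).proj = z.1 := by
    intro z hz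
    exact congrArg Prod.fst ((extChartAt I.tangent w).right_inv hz)
  refine h1.congr_of_eventuallyEq ?_ (h2 _ (mem_extChartAt_target w))
  filter_upwards [hev] with z hz
  exact h2 z hz

theorem speed_eq_one (g : Metric I M) {γ : ℝ → TangentBundle I M} {J : Set ℝ}
    (h : IsFlowCurve g γ J) {t : ℝ} (ht : t ∈ J) (hJ : UniqueDiffWithinAt ℝ J t) :
    (let c' : TangentSpace I (γ t).proj :=
      (mfderiv[J] (fun t => (γ t).proj) t : ℝ →L[ℝ] TangentSpace I (γ t).proj) 1
    ENNReal.ofReal √(g.inner (γ t).proj c' c')) = 1 := by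
  have h1 := ((hasMFDerivAt_proj (γ t)).comp_hasMFDerivWithinAt t
    (h.isMIntegralCurveOn t ht)).mfderivWithin hJ.uniqueMDiffWithinAt
  have h2 : (mfderiv[J] (fun t => (γ t).proj) t : ℝ →L[ℝ] TangentSpace I (γ t).proj) 1 =
      (γ t).snd := by
    refine (congrArg (fun L : ℝ →L[ℝ] E => L 1) h1).trans ?_
    exact one_smul ℝ (γ t).snd
  have h3 : g.inner (γ t).proj (γ t).snd (γ t).snd = 1 := h.mem_unitTangent t ht
  simp only [h2, h3]
  simp

/-- Flow curves project to unit-speed curves. On a one-point domain the derivative within it need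
not be unique, but the set has measure zero. -/
theorem curveLength_eq_volume (g : Metric I M) {γ : ℝ → TangentBundle I M} {J : Set ℝ}
    (h : IsFlowCurve g γ J) : curveLength g (fun t => (γ t).proj) J = MeasureTheory.volume J := by
  have hm : MeasurableSet J := h.ordConnected.measurableSet
  by_cases hJ : J.Subsingleton
  · have h0 : MeasureTheory.volume J = 0 := hJ.measure_zero _
    rw [curveLength, MeasureTheory.setLIntegral_measure_zero _ _ h0, h0]
  · have hu : UniqueDiffOn ℝ J := by
      refine uniqueDiffOn_convex h.ordConnected.convex ?_
      obtain ⟨a, ha, b, hb, hab⟩ := (not_subsingleton_iff.1 hJ).exists_lt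
      refine ⟨(a + b) / 2, mem_interior.2 ⟨Ioo a b, ?_, isOpen_Ioo, ?_⟩⟩
      · exact Ioo_subset_Icc_self.trans (h.ordConnected.out ha hb)
      · constructor <;> linarith
    rw [curveLength, MeasureTheory.setLIntegral_congr_fun hm
      (fun t ht => speed_eq_one g h ht (hu t ht))]
    simp

/-! ### Embedding the geodesic flow in a vector space -/

theorem tangentLift_injective {f : M → W} (hf : Function.Injective f)
    (hinj : ∀ x, Function.Injective (mfderiv I 𝓘(ℝ, W) f x)) :
    Function.Injective (tangentLift I f) := by
  rintro ⟨x, p⟩ ⟨x', p'⟩ h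
  obtain ⟨h1, h2⟩ := Prod.mk_inj.1 h
  obtain rfl : x = x' := hf h1
  obtain rfl : p = p' := hinj x h2
  rfl

/-- Tietze extension from the compact image, multiplied by a cut-off equal to 1 there; compact
support yields boundedness and uniform continuity. -/
theorem exists_uniformContinuous_extension {X Y Z : Type*} [TopologicalSpace X]
    [NormedAddCommGroup Y] [NormedSpace ℝ Y] [FiniteDimensional ℝ Y]
    [NormedAddCommGroup Z] [NormedSpace ℝ Z] [FiniteDimensional ℝ Z] {K : Set X}
    (hK : IsCompact K) {e : X → Y} (he : Continuous e) (hinj : InjOn e K) {v : X → Z}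
    (hv : Continuous v) :
    ∃ (V : Y → Z) (C : ℝ), UniformContinuous V ∧ (∀ y, ‖V y‖ ≤ C) ∧ ∀ x ∈ K, V (e x) = v x := by
  have : CompactSpace K := isCompact_iff_compactSpace.1 hK
  have : TietzeExtension Z := TietzeExtension.of_tvs ℝ
  have hcl : Topology.IsClosedEmbedding (fun x : K => e x) :=
    (he.comp continuous_subtype_val).isClosedEmbedding (injOn_iff_injective.1 hinj)
  obtain ⟨V₀, hV₀⟩ := ContinuousMap.exists_extension' hcl
    (⟨fun x : K => v x, hv.comp continuous_subtype_val⟩ : C(K, Z))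
  obtain ⟨R, hR, hKR⟩ := (hK.image he).isBounded.subset_ball_lt 0 0
  let φ : ContDiffBump (0 : Y) := ⟨R, R + 1, hR, by linarith⟩
  have hcont : Continuous fun y => φ y • V₀ y := φ.continuous.smul V₀.continuous
  have hsupp : HasCompactSupport fun y => φ y • V₀ y := φ.hasCompactSupport.smul_right
  obtain ⟨C, hC⟩ := hcont.bounded_above_of_compact_support hsupp
  refine ⟨_, C, hsupp.uniformContinuous_of_continuous hcont, hC, fun x hx => ?_⟩
  rw [φ.one_of_mem_closedBall (Metric.ball_subset_closedBall (hKR (mem_image_of_mem e hx))),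
    one_smul]
  exact congrFun hV₀ ⟨x, hx⟩

/-- An embedding `ι` of the unit tangent bundle into a vector space `W`, together with a vector
field `V` on `W` that extends the image of the geodesic field. -/
structure IsFlowEmbedding (g : Metric I M) (ι : TangentBundle I M → W) (V : W → W) (C : ℝ) :
    Prop where
  contMDiff : ContMDiff I.tangent 𝓘(ℝ, W) ∞ ι
  injective : Function.Injective ι
  uniformContinuous : UniformContinuous V
  norm_le : ∀ x, ‖V x‖ ≤ C
  ne_zero : ∀ w ∈ unitTangent g, V (ι w) ≠ 0
  derivAlongField_comp : ∀ F : W → ℝ, ContDiff ℝ ∞ F → ∀ w ∈ unitTangent g,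
    derivAlongField g (F ∘ ι) w = fderiv ℝ F (ι w) (V (ι w))
  hasDerivWithinAt : ∀ (γ : ℝ → TangentBundle I M) (J : Set ℝ) (t : ℝ), γ t ∈ unitTangent g →
    HasMFDerivWithinAt 𝓘(ℝ, ℝ) I.tangent γ J t
      ((1 : ℝ →L[ℝ] ℝ).smulRight (geodesicField g (γ t))) →
    HasDerivWithinAt (fun s => ι (γ s)) (V (ι (γ t))) J t
  hasMFDerivWithinAt : ∀ (γ : ℝ → TangentBundle I M) (J : Set ℝ) (t : ℝ), γ t ∈ unitTangent g →
    ContinuousWithinAt γ J t → HasDerivWithinAt (fun s => ι (γ s)) (V (ι (γ t))) J t →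
    HasMFDerivWithinAt 𝓘(ℝ, ℝ) I.tangent γ J t
      ((1 : ℝ →L[ℝ] ℝ).smulRight (geodesicField g (γ t)))

theorem exists_isFlowEmbedding [FiniteDimensional ℝ E] [T2Space M] [CompactSpace M]
    (g : Metric I M) :
    ∃ (n : ℕ) (ι : TangentBundle I M → EuclideanSpace ℝ (Fin n) × EuclideanSpace ℝ (Fin n))
      (V : EuclideanSpace ℝ (Fin n) × EuclideanSpace ℝ (Fin n) →
        EuclideanSpace ℝ (Fin n) × EuclideanSpace ℝ (Fin n)) (C : ℝ), IsFlowEmbedding g ι V C := by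
  obtain ⟨n, e, he, hemb, hinj⟩ := exists_embedding_euclidean_of_compact (I := I) (M := M)
  have hι := contMDiff_tangentLift he
  have hιinj := tangentLift_injective hemb.injective hinj
  obtain ⟨V, C, hV, hC, hVι⟩ := exists_uniformContinuous_extension (isCompact_unitTangent g)
    hι.continuous hιinj.injOn (continuous_liftedField g he)
  refine ⟨n, tangentLift I e, V, C, hι, hιinj, hV, hC, fun w hw => ?_, fun F hF w hw => ?_,
    fun γ J t ht h => ?_, fun γ J t ht hγ h => ?_⟩
  · rw [hVι w hw]
    intro h0
    -- The derivative of the lift is injective and the position component of the field is the unit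
    -- vector `w.snd`, so the image cannot vanish.
    have h1 : (geodesicField g w : E × E) = 0 :=
      liftDeriv_injective_of_mfderiv he (hinj w.proj) _ (h0.trans (map_zero _).symm)
    have h2 : w.snd = 0 := congrArg Prod.fst h1
    have h3 : g.inner w.proj w.snd w.snd = 1 := hw
    rw [h2, map_zero] at h3
    exact zero_ne_one h3
  · have h1 := ((hF.differentiable (by simp) (tangentLift I e w)).hasFDerivAt.hasMFDerivAt.comp w
      (hasMFDerivAt_tangentLift he w)).mfderiv
    rw [hVι w hw]
    exact congrArg (fun L : E × E →L[ℝ] ℝ => L (geodesicField g w)) h1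
  · rw [hVι _ ht]
    exact hasDerivWithinAt_tangentLift g he h
  · rw [hVι _ ht] at h
    exact hasMFDerivWithinAt_of_tangentLift g he hinj hγ h

/-! ### Limits, completeness and maximality of flow curves -/

namespace IsFlowEmbedding

variable {g : Metric I M} {ι : TangentBundle I M → W} {V : W → W} {C : ℝ}

theorem isPseudoOrbit (h : IsFlowEmbedding g ι V C) {γ : ℝ → TangentBundle I M} {J : Set ℝ}
    (hγ : IsFlowCurve g γ J) {a b : ℝ} (hab : Icc a b ⊆ J) :
    IsPseudoOrbit V (ι '' unitTangent g) 0 a b (fun t => ι (γ t)) := by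
  have hd : ∀ t ∈ J, HasDerivWithinAt (fun s => ι (γ s)) (V (ι (γ t))) J t := fun t ht =>
    h.hasDerivWithinAt γ J t (hγ.mem_unitTangent t ht) (hγ.isMIntegralCurveOn t ht)
  refine ⟨fun t ht => (hd t (hab ht)).continuousWithinAt.mono hab, fun t ht => ?_, fun t ht => ?_⟩
  · rw [Metric.infDist_zero_of_mem (mem_image_of_mem ι (hγ.mem_unitTangent t (hab ht)))]
  · refine ⟨_, ((hd t (hab (Ico_subset_Icc_self ht))).mono hab).mono_of_mem_nhdsWithin ?_, ?_⟩
    · exact mem_of_superset (Icc_mem_nhdsGE ht.2) (Icc_subset_Icc_left ht.1)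
    · simp

theorem exists_isFlowCurve [FiniteDimensional ℝ E] [CompactSpace M]
    (h : IsFlowEmbedding g ι V C) {c : ℝ → W} {J : Set ℝ}
    (hne : J.Nonempty) (hJ : J.OrdConnected) (hc : ∀ t ∈ J, c t ∈ ι '' unitTangent g)
    (hd : ∀ t ∈ J, HasDerivWithinAt c (V (c t)) J t) :
    ∃ γ, IsFlowCurve g γ J ∧ ∀ t ∈ J, ι (γ t) = c t := by
  have : Nonempty (TangentBundle I M) := let ⟨t, ht⟩ := hne; ⟨(hc t ht).choose⟩
  choose! γ hγ hγc using hc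
  refine ⟨γ, ⟨hne, hJ, hγ, fun t ht => ?_⟩, hγc⟩
  have : CompactSpace (unitTangent g) := isCompact_iff_compactSpace.1 (isCompact_unitTangent g)
  have hcl : Topology.IsClosedEmbedding (fun w : unitTangent g => ι w) :=
    (h.contMDiff.continuous.comp continuous_subtype_val).isClosedEmbedding
      (h.injective.comp Subtype.val_injective)
  have hcont : ContinuousWithinAt γ J t := by
    rw [continuousWithinAt_iff_continuousAt_domRestrict _ ht]
    have h1 : ContinuousAt (fun s : J => (⟨γ s, hγ s s.2⟩ : unitTangent g)) ⟨t, ht⟩ := by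
      rw [hcl.isEmbedding.isInducing.continuousAt_iff]
      refine ContinuousAt.congr (f := fun s : J => c s) ?_
        (Eventually.of_forall fun s => (hγc s s.2).symm)
      exact (continuousWithinAt_iff_continuousAt_domRestrict c ht).1 (hd t ht).continuousWithinAt
    exact continuous_subtype_val.continuousAt.comp h1
  refine h.hasMFDerivWithinAt γ J t (hγ t ht) hcont ?_
  rw [hγc t ht]
  exact (hd t ht).congr hγc (hγc t ht)

theorem isCompact_image [FiniteDimensional ℝ E] [CompactSpace M] (h : IsFlowEmbedding g ι V C) :
    IsCompact (ι '' unitTangent g) :=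
  (isCompact_unitTangent g).image h.contMDiff.continuous

theorem isClosedEmbedding [FiniteDimensional ℝ E] [CompactSpace M] (h : IsFlowEmbedding g ι V C) :
    Topology.IsClosedEmbedding (fun w : unitTangent g => ι w) :=
  have : CompactSpace (unitTangent g) := isCompact_iff_compactSpace.1 (isCompact_unitTangent g)
  (h.contMDiff.continuous.comp continuous_subtype_val).isClosedEmbedding
    (h.injective.comp Subtype.val_injective)

/-- Longer and longer pieces of a flow curve converge to a complete flow curve. -/
theorem exists_limit [FiniteDimensional ℝ E] [FiniteDimensional ℝ W] [CompactSpace M]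
    (h : IsFlowEmbedding g ι V C) {γ : ℝ → TangentBundle I M} {J : Set ℝ}
    (hγ : IsFlowCurve g γ J) (τ : ℕ → ℝ) (hτ : ∀ m : ℕ, Icc (τ m - m) (τ m + m) ⊆ J) :
    ∃ γ', IsFlowCurve g γ' univ ∧
      ∀ t, Tendsto (fun m => ι (γ (t + τ m))) (hyperfilter ℕ : Filter ℕ) (𝓝 (ι (γ' t))) := by
  obtain ⟨t₀, ht₀⟩ := hγ.nonempty
  obtain ⟨c, hc⟩ := exists_orbit_of_isPseudoOrbit (ε := fun _ => 0) (a := fun m => τ m - m - τ m)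
    (b := fun m => τ m + m - τ m) (c := fun m t => ι (γ (t + τ m))) h.isCompact_image
    ⟨_, mem_image_of_mem ι (hγ.mem_unitTangent t₀ ht₀)⟩ h.uniformContinuous h.norm_le
    tendsto_const_nhds
    (by simpa using tendsto_natCast_atTop_atTop (R := ℝ))
    (by simpa using tendsto_natCast_atTop_atTop (R := ℝ))
    (fun m => (h.isPseudoOrbit hγ (hτ m)).comp_add (τ m)) (hyperfilter ℕ) Nat.hyperfilter_le_atTop
  obtain ⟨γ', hγ', hγ'c⟩ := h.exists_isFlowCurve (c := c) univ_nonempty ordConnected_univ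
    (fun t _ => (hc t).1) (fun t _ => (hc t).2.1.hasDerivWithinAt)
  exact ⟨γ', hγ', fun t => by rw [hγ'c t trivial]; exact (hc t).2.2⟩

/-- If J is unbounded in one direction, the points t₀ ± m on that side are centres of intervals of
radius m contained in J. -/
theorem exists_complete [FiniteDimensional ℝ E] [FiniteDimensional ℝ W] [CompactSpace M]
    (h : IsFlowEmbedding g ι V C) {γ : ℝ → TangentBundle I M} {J : Set ℝ}
    (hγ : IsFlowCurve g γ J) (hJ : ¬ Bornology.IsBounded J) : ∃ γ', IsFlowCurve g γ' univ := by
  obtain ⟨t₀, ht₀⟩ := hγ.nonempty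
  rw [isBounded_iff_bddBelow_bddAbove, not_and_or] at hJ
  rcases hJ with hJ | hJ
  · rw [not_bddBelow_iff] at hJ
    obtain ⟨γ', hγ', -⟩ := h.exists_limit hγ (fun m => t₀ - m) fun m => by
      obtain ⟨r, hr, hrm⟩ := hJ (t₀ - m - m)
      refine (Icc_subset_Icc hrm.le (le_of_eq ?_)).trans (hγ.ordConnected.out hr ht₀)
      ring
    exact ⟨γ', hγ'⟩
  · rw [not_bddAbove_iff] at hJ
    obtain ⟨γ', hγ', -⟩ := h.exists_limit hγ (fun m => t₀ + m) fun m => by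
      obtain ⟨r, hr, hrm⟩ := hJ (t₀ + m + m)
      refine (Icc_subset_Icc (le_of_eq ?_) hrm.le).trans (hγ.ordConnected.out ht₀ hr)
      ring
    exact ⟨γ', hγ'⟩

theorem isGradientType [FiniteDimensional ℝ E] [FiniteDimensional ℝ W] [CompactSpace M]
    (h : IsFlowEmbedding g ι V C) (hg : ¬ ∃ γ, IsFlowCurve g γ univ) : IsGradientType g := by
  obtain ⟨F, hF, hpos⟩ := exists_contDiff_fderiv_pos h.isCompact_image h.uniformContinuous
    h.norm_le (fun ⟨c, hc⟩ => hg <| by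
      obtain ⟨γ, hγ, -⟩ := h.exists_isFlowCurve (c := c) univ_nonempty ordConnected_univ
        (fun t _ => (hc t).1) (fun t _ => (hc t).2.hasDerivWithinAt)
      exact ⟨γ, hγ⟩)
  refine ⟨fun w => F (ι w), fun w => ⟨univ, F ∘ ι, isOpen_univ, mem_univ _,
    (hF.contMDiff.comp h.contMDiff).contMDiffOn, fun _ _ => rfl, ?_⟩⟩
  rw [h.derivAlongField_comp F hF w w.2]
  exact hpos _ (mem_image_of_mem ι w.2)

/-- A maximal flow curve is defined on a closed interval. -/
theorem isClosed_of_isMaximalFlowCurve [FiniteDimensional ℝ E] [FiniteDimensional ℝ W]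
    [CompactSpace M] (h : IsFlowEmbedding g ι V C) {γ : ℝ → TangentBundle I M} {J : Set ℝ}
    (hγ : IsMaximalFlowCurve g γ J) : IsClosed J := by
  have hC0 : 0 ≤ C := (norm_nonneg _).trans (h.norm_le 0)
  have hO := hγ.1.ordConnected
  have hps : ∀ s ∈ J, ∀ t ∈ J, IsPseudoOrbit V (ι '' unitTangent g) 0 (min s t) (max s t)
      (fun t => ι (γ t)) := fun s hs t ht =>
    h.isPseudoOrbit hγ.1 (by simpa [uIcc] using hO.uIcc_subset hs ht)
  -- Bounded speed makes the embedded curve Lipschitz, so it extends continuously to the missing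
  -- endpoints of J.
  have hlip : LipschitzOnWith ⟨C, hC0⟩ (fun t => ι (γ t)) J := by
    refine LipschitzOnWith.of_dist_le_mul fun s hs t ht => ?_
    rw [dist_eq_norm, dist_comm, Real.dist_eq]
    change _ ≤ C * _
    wlog hst : t ≤ s generalizing s t
    · rw [norm_sub_rev, abs_sub_comm]
      exact this t ht s hs (le_of_not_ge hst)
    have := (hps s hs t ht).norm_sub_le h.norm_le (min_le_right _ _) hst (le_max_left _ _)
    rwa [add_zero, ← abs_of_nonneg (sub_nonneg.2 hst), abs_sub_comm] at this
  obtain ⟨c, hc, hcJ⟩ := hlip.extend_finite_dimension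
  have hcK : ∀ t ∈ closure J, c t ∈ ι '' unitTangent g := by
    intro t ht
    refine h.isCompact_image.isClosed.closure_subset_iff.2 ?_
      (image_closure_subset_closure_image hc.continuous (mem_image_of_mem c ht))
    rintro _ ⟨s, hs, rfl⟩
    exact ⟨γ s, hγ.1.mem_unitTangent s hs, hcJ hs⟩
  have hd : ∀ t ∈ closure J, HasDerivWithinAt c (V (c t)) (closure J) t := by
    intro t ht
    rw [hasDerivWithinAt_iff_isLittleO, Asymptotics.isLittleO_iff]
    intro κ hκ
    obtain ⟨δ, hδ, hVδ⟩ := Metric.uniformContinuous_iff.1 h.uniformContinuous (κ / 2) (half_pos hκ)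
    have hδ' : 0 < δ / 2 / (C + 1) := by positivity
    have hη : ∀ x y, ‖x - y‖ ≤ (C + 0) * (δ / 2 / (C + 1)) → ‖V x - V y‖ ≤ κ / 2 := by
      intro x y hxy
      rw [← dist_eq_norm]
      refine (hVδ ?_).le
      rw [dist_eq_norm]
      refine hxy.trans_lt ?_
      calc (C + 0) * (δ / 2 / (C + 1)) ≤ (C + 1) * (δ / 2 / (C + 1)) :=
            mul_le_mul_of_nonneg_right (by linarith) hδ'.le
        _ = δ / 2 := by field_simp
        _ < δ := by linarith
    have hmem : ∀ᶠ s in 𝓝[closure J] t, |s - t| < δ / 2 / (C + 1) :=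
      nhdsWithin_le_nhds (Metric.ball_mem_nhds t hδ')
    filter_upwards [hmem, self_mem_nhdsWithin] with s hs hsJ
    -- The first-order estimate is uniform over pairs in J at bounded distance and is a closed
    -- condition, so it persists for pairs in the closure, endpoints included.
    have hst : (s, t) ∈ closure (J ×ˢ J) := by
      rw [closure_prod_eq]; exact ⟨hsJ, ht⟩
    have hopen : IsOpen {q : ℝ × ℝ | |q.1 - q.2| < δ / 2 / (C + 1)} :=
      isOpen_lt (by fun_prop) continuous_const
    have hcl : IsClosed {q : ℝ × ℝ | ‖c q.1 - c q.2 - (q.1 - q.2) • V (c q.2)‖ ≤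
        κ * ‖q.1 - q.2‖} := by
      have hcc := hc.continuous
      have hVc := h.uniformContinuous.continuous
      exact isClosed_le (by fun_prop) (by fun_prop)
    have hst' : (s, t) ∈ closure (J ×ˢ J ∩ {q : ℝ × ℝ | |q.1 - q.2| < δ / 2 / (C + 1)}) :=
      by
      rw [inter_comm]
      exact hopen.inter_closure ⟨hs, hst⟩
    refine hcl.closure_subset_iff.2 ?_ hst'
    rintro ⟨s', t'⟩ ⟨⟨hs', ht'⟩, hst''⟩
    change ‖c s' - c t' - (s' - t') • V (c t')‖ ≤ κ * ‖s' - t'‖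
    rw [← hcJ hs', ← hcJ ht']
    have := (hps t' ht' s' hs').norm_sub_sub_le h.norm_le hη (by linarith)
      ⟨min_le_left _ _, le_max_left _ _⟩ ⟨min_le_right _ _, le_max_right _ _⟩
      (le_of_lt hst'')
    simpa [mul_div_cancel₀] using this
  obtain ⟨γ', hγ', hγ'c⟩ := h.exists_isFlowCurve (hγ.1.nonempty.closure)
    hO.convex.closure.ordConnected hcK hd
  have := hγ.2 γ' (closure J) hγ' subset_closure fun t ht => h.injective (by
    rw [hγ'c t (subset_closure ht), ← hcJ ht])
  rw [← this]
  exact isClosed_closure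

/-- A flow curve is locally injective. -/
theorem exists_injOn (h : IsFlowEmbedding g ι V C) {γ : ℝ → TangentBundle I M}
    (hγ : IsFlowCurve g γ univ) (t₀ : ℝ) : ∃ r > 0, InjOn γ (Icc (t₀ - r) (t₀ + r)) := by
  have hC0 : 0 ≤ C := (norm_nonneg _).trans (h.norm_le 0)
  have hcont : Continuous fun t => V (ι (γ t)) := by
    refine h.uniformContinuous.continuous.comp ?_
    rw [← continuousOn_univ]
    exact fun t ht => (h.hasDerivWithinAt γ univ t (hγ.mem_unitTangent t ht)
      (hγ.isMIntegralCurveOn t ht)).continuousWithinAt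
  have hpos : 0 < ‖V (ι (γ t₀))‖ := norm_pos_iff.2 (h.ne_zero _ (hγ.mem_unitTangent t₀ trivial))
  -- A coincidence γ s = γ t would give |t - s| ‖V‖ ≤ 2 κ |t - s|, while ‖V‖ stays above 2 κ near
  -- t₀.
  set κ := ‖V (ι (γ t₀))‖ / 4 with hκ
  have hκ0 : 0 < κ := by positivity
  obtain ⟨δ, hδ, hVδ⟩ := Metric.uniformContinuous_iff.1 h.uniformContinuous κ hκ0
  have hδ' : 0 < δ / 2 / (C + 1) := by positivity
  have hη : ∀ x y, ‖x - y‖ ≤ (C + 0) * (δ / 2 / (C + 1)) → ‖V x - V y‖ ≤ κ := by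
    intro x y hxy
    rw [← dist_eq_norm]
    refine (hVδ ?_).le
    rw [dist_eq_norm]
    refine hxy.trans_lt ?_
    calc (C + 0) * (δ / 2 / (C + 1)) ≤ (C + 1) * (δ / 2 / (C + 1)) :=
          mul_le_mul_of_nonneg_right (by linarith) hδ'.le
      _ = δ / 2 := by field_simp
      _ < δ := by linarith
  have hev : ∀ᶠ t in 𝓝 t₀, 2 * κ < ‖V (ι (γ t))‖ :=
    hcont.norm.continuousAt.eventually_const_lt (by rw [hκ]; linarith)
  obtain ⟨r, hr, hball⟩ := Metric.nhds_basis_closedBall.eventually_iff.1 hev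
  refine ⟨min r (δ / 2 / (C + 1) / 2), by positivity, fun s hs t ht hst => ?_⟩
  have hbr : ∀ s ∈ Icc (t₀ - min r (δ / 2 / (C + 1) / 2)) (t₀ + min r (δ / 2 / (C + 1) / 2)),
      |s - t₀| ≤ min r (δ / 2 / (C + 1) / 2) := fun s hs =>
    abs_le.2 ⟨by linarith [hs.1], by linarith [hs.2]⟩
  have hs1 := hbr s hs
  have ht1 := hbr t ht
  have hts : |t - s| ≤ δ / 2 / (C + 1) := by
    have h1 := abs_sub_le t t₀ s
    rw [abs_sub_comm t₀ s] at h1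
    linarith [min_le_right r (δ / 2 / (C + 1) / 2)]
  have h1 := (h.isPseudoOrbit hγ (subset_univ (Icc (t₀ - min r (δ / 2 / (C + 1) / 2))
    (t₀ + min r (δ / 2 / (C + 1) / 2))))).norm_sub_sub_le h.norm_le hη (by linarith) hs ht hts
  have h2 : 2 * κ < ‖V (ι (γ s))‖ := hball (by
    rw [Metric.mem_closedBall, Real.dist_eq]
    exact hs1.trans (min_le_left _ _))
  simp only [hst, sub_self, zero_sub, norm_neg, norm_smul, zero_add, Real.norm_eq_abs] at h1
  by_contra hne
  have h3 : 0 < |t - s| := abs_pos.2 (sub_ne_zero.2 (Ne.symm hne))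
  rw [hst] at h2
  nlinarith

end IsFlowEmbedding

/-! ### Lyapunov functions along flow curves -/

variable {g : Metric I M} {F : unitTangent g → ℝ} {γ : ℝ → TangentBundle I M} {J : Set ℝ}

theorem IsFlowCurve.continuousOn (hγ : IsFlowCurve g γ J) : ContinuousOn γ J :=
  fun t ht => (hγ.isMIntegralCurveOn t ht).continuousWithinAt

theorem IsLyapunov.continuous (hF : IsLyapunov g F) : Continuous F := by
  rw [continuous_iff_continuousAt]
  intro w
  obtain ⟨U, F', hU, hw, hF', hFF', -⟩ := hF w
  have h1 : ContinuousAt (fun z : unitTangent g => F' z) w :=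
    ContinuousAt.comp (g := F') (hF'.continuousOn.continuousAt (hU.mem_nhds hw))
      continuous_subtype_val.continuousAt
  refine h1.congr ?_
  filter_upwards [continuous_subtype_val.continuousAt.preimage_mem_nhds (hU.mem_nhds hw)] with z hz
  exact hFF' z hz

theorem IsLyapunov.hasDerivWithinAt (hF : IsLyapunov g F) (hγ : IsFlowCurve g γ J) {f : ℝ → ℝ}
    (hf : ∀ t (ht : t ∈ J), f t = F ⟨γ t, hγ.mem_unitTangent t ht⟩) {t : ℝ} (ht : t ∈ J) :
    ∃ d > 0, HasDerivWithinAt f d J t := by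
  obtain ⟨U, F', hU, hw, hF', hFF', hpos⟩ := hF ⟨γ t, hγ.mem_unitTangent t ht⟩
  refine ⟨_, hpos, ?_⟩
  have h1 : HasMFDerivAt I.tangent 𝓘(ℝ, ℝ) F' (γ t) (mfderiv I.tangent 𝓘(ℝ, ℝ) F' (γ t)) :=
    ((hF'.contMDiffAt (hU.mem_nhds hw)).mdifferentiableAt (by simp)).hasMFDerivAt
  have h2 := (h1.comp_hasMFDerivWithinAt t (hγ.isMIntegralCurveOn t ht)).hasFDerivWithinAt
  have h3 : HasDerivWithinAt (F' ∘ γ) (derivAlongField g F' (γ t)) J t := by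
    let L : E × E →L[ℝ] ℝ := mfderiv I.tangent 𝓘(ℝ, ℝ) F' (γ t)
    let v : E × E := geodesicField g (γ t)
    have h4 : HasFDerivWithinAt (F' ∘ γ) (L ∘L (1 : ℝ →L[ℝ] ℝ).smulRight v) J t := h2
    have h5 := h4.hasDerivWithinAt
    rwa [ContinuousLinearMap.comp_apply, ContinuousLinearMap.smulRight_apply,
      one_apply_eq_self, one_smul] at h5
  refine h3.congr_of_eventuallyEq ?_ ((hf t ht).trans (hFF' _ hw).symm)
  filter_upwards [(hγ.continuousOn t ht).preimage_mem_nhdsWithin (hU.mem_nhds hw),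
    self_mem_nhdsWithin] with s hs hsJ
  exact (hf s hsJ).trans (hFF' ⟨γ s, hγ.mem_unitTangent s hsJ⟩ hs).symm

theorem IsLyapunov.strictMonoOn (hF : IsLyapunov g F) (hγ : IsFlowCurve g γ J) {f : ℝ → ℝ}
    (hf : ∀ t (ht : t ∈ J), f t = F ⟨γ t, hγ.mem_unitTangent t ht⟩) : StrictMonoOn f J := by
  refine strictMonoOn_of_deriv_pos hγ.ordConnected.convex
    (fun t ht => (hF.hasDerivWithinAt hγ hf ht).choose_spec.2.continuousWithinAt) fun t ht => ?_
  obtain ⟨d, hd, h⟩ := hF.hasDerivWithinAt hγ hf (interior_subset ht)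
  rwa [(h.hasDerivAt (mem_interior_iff_mem_nhds.1 ht)).deriv]

theorem IsLyapunov.injOn (hF : IsLyapunov g F) (hγ : IsFlowCurve g γ J) : InjOn γ J := by
  classical
  let f : ℝ → ℝ := fun t => if ht : t ∈ J then F ⟨γ t, hγ.mem_unitTangent t ht⟩ else 0
  have hf : ∀ t (ht : t ∈ J), f t = F ⟨γ t, hγ.mem_unitTangent t ht⟩ := fun t ht => dif_pos ht
  intro s hs t ht hst
  refine (hF.strictMonoOn hγ hf).injOn hs ht ?_
  simp only [hf s hs, hf t ht, hst]

theorem HasClosedGeodesic.exists_isFlowCurve_univ (h : HasClosedGeodesic g) :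
    ∃ γ, IsFlowCurve g γ univ :=
  ⟨h.choose, h.choose_spec.1⟩

theorem IsFlowCurve.isMaximalFlowCurve (hγ : IsFlowCurve g γ univ) :
    IsMaximalFlowCurve g γ univ :=
  ⟨hγ, fun _ _ _ h _ => univ_subset_iff.1 h⟩

theorem IsNonTrapping.not_exists_isFlowCurve_univ (h : IsNonTrapping g) :
    ¬ ∃ γ, IsFlowCurve g γ univ :=
  fun ⟨γ, hγ⟩ => h.2 ⟨γ, univ, hγ, by rw [curveLength_eq_volume g hγ, Real.volume_univ]⟩

/-! ### Gradient type, trajectories and trapping in terms of complete curves -/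

namespace IsFlowEmbedding

variable {ι : TangentBundle I M → W} {V : W → W} {C : ℝ} [FiniteDimensional ℝ E]
  [FiniteDimensional ℝ W] [CompactSpace M]

theorem not_exists_isFlowCurve_univ_of_isLyapunov (h : IsFlowEmbedding g ι V C)
    (hF : IsLyapunov g F) : ¬ ∃ γ, IsFlowCurve g γ univ := by
  rintro ⟨γ, hγ⟩
  have : CompactSpace (unitTangent g) := isCompact_iff_compactSpace.1 (isCompact_unitTangent g)
  have hmono : StrictMono fun t => F ⟨γ t, hγ.mem_unitTangent t trivial⟩ :=
    strictMonoOn_univ.1 (hF.strictMonoOn hγ fun _ _ => rfl)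
  have hbdd : BddAbove (range fun t => F ⟨γ t, hγ.mem_unitTangent t trivial⟩) :=
    (isCompact_range hF.continuous).bddAbove.mono
      (range_subset_iff.2 fun t => mem_range_self (f := F) _)
  have hlim := tendsto_atTop_ciSup hmono.monotone hbdd
  -- The limit of the translates γ (t + m) is a complete curve on which F is constantly equal to its
  -- limit along γ.
  obtain ⟨γ', hγ', hγγ'⟩ := h.exists_limit hγ (fun m => m) fun m => subset_univ _
  have hconst : ∀ t, F ⟨γ' t, hγ'.mem_unitTangent t trivial⟩ =
      ⨆ t, F ⟨γ t, hγ.mem_unitTangent t trivial⟩ := by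
    intro t
    have h1 : Tendsto (fun m : ℕ => (⟨γ (t + m), hγ.mem_unitTangent _ trivial⟩ : unitTangent g))
        (hyperfilter ℕ : Filter ℕ) (𝓝 ⟨γ' t, hγ'.mem_unitTangent t trivial⟩) :=
      h.isClosedEmbedding.isEmbedding.tendsto_nhds_iff.2 (hγγ' t)
    refine tendsto_nhds_unique (hF.continuous.continuousAt.tendsto.comp h1) ?_
    exact hlim.comp ((tendsto_atTop_add_const_left _ t tendsto_natCast_atTop_atTop).mono_left
      Nat.hyperfilter_le_atTop)
  have h01 := (hF.strictMonoOn hγ' (f := fun t => F ⟨γ' t, hγ'.mem_unitTangent t trivial⟩)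
    fun _ _ => rfl) (mem_univ 0) (mem_univ 1) one_pos
  simp only [hconst, lt_irrefl] at h01

/-- The domain is closed by maximality and bounded for lack of complete curves. The curve is
injective because F increases along it, and a continuous injection of a compact interval into a
Hausdorff space is a homeomorphism onto its image. -/
theorem nonempty_homeomorph_of_isLyapunov (h : IsFlowEmbedding g ι V C) (hF : IsLyapunov g F)
    {T : Set (TangentBundle I M)} (hT : IsTrajectory g T) :
    Nonempty (T ≃ₜ Icc (0 : ℝ) 1) ∨ ∃ w, T = {w} := by
  obtain ⟨γ, J, hγ, rfl⟩ := hT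
  have hb : Bornology.IsBounded J := by
    by_contra hb
    exact h.not_exists_isFlowCurve_univ_of_isLyapunov hF (h.exists_complete hγ.1 hb)
  have hJ : IsCompact J := Metric.isCompact_of_isClosed_isBounded
    (h.isClosed_of_isMaximalFlowCurve hγ) hb
  have hIcc := eq_Icc_of_connected_compact
    ⟨hγ.1.nonempty, hγ.1.ordConnected.isPreconnected⟩ hJ
  rcases (Real.sInf_le_sSup J hb.bddBelow hb.bddAbove).eq_or_lt with hab | hab
  · right
    rw [← hab, Icc_self] at hIcc
    exact ⟨γ (sInf J), by rw [hIcc, image_singleton, csInf_singleton]⟩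
  · left
    have : CompactSpace J := isCompact_iff_compactSpace.1 hJ
    have : T2Space (TangentBundle I M) := .of_injective_continuous h.injective h.contMDiff.continuous
    have e : J ≃ₜ γ '' J := Continuous.homeoOfEquivCompactToT2
      (f := Equiv.Set.imageOfInjOn γ J (hF.injOn hγ.1))
      (hγ.1.continuousOn.domRestrict.subtype_mk _)
    exact ⟨e.symm.trans ((Homeomorph.setCongr hIcc).trans (iccHomeoI _ _ hab))⟩

omit [FiniteDimensional ℝ E] [FiniteDimensional ℝ W] [CompactSpace M] in
-- A complete curve is maximal. Were its image an arc, the arc coordinate would reach its maximum 1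
-- at some t₀ ∈ ℝ, although by local injectivity it is strictly monotone around t₀. Only local
-- injectivity is used, so periodic curves are covered as well.
theorem not_exists_isFlowCurve_univ_of_forall_isTrajectory (h : IsFlowEmbedding g ι V C)
    (hg : ∀ T, IsTrajectory g T → Nonempty (T ≃ₜ Icc (0 : ℝ) 1) ∨ ∃ w, T = {w}) :
    ¬ ∃ γ, IsFlowCurve g γ univ := by
  rintro ⟨γ, hγ⟩
  have hmem : ∀ t, γ t ∈ γ '' univ := fun t => mem_image_of_mem γ trivial
  rcases hg _ ⟨γ, univ, hγ.isMaximalFlowCurve, rfl⟩ with ⟨⟨e⟩⟩ | ⟨w, hw⟩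
  · let f : ℝ → ℝ := fun t => e ⟨γ t, hmem t⟩
    have hf : Continuous f := continuous_subtype_val.comp
      (e.continuous.comp ((continuousOn_univ.1 hγ.continuousOn).subtype_mk hmem))
    have hf1 : ∀ t, f t ≤ 1 := fun t => (e ⟨γ t, hmem t⟩).2.2
    obtain ⟨t₀, ht₀⟩ : ∃ t₀, f t₀ = 1 := by
      obtain ⟨t₀, -, ht₀⟩ := (e.symm ⟨1, by simp⟩).2
      refine ⟨t₀, ?_⟩
      change ((e ⟨γ t₀, _⟩ : Icc (0 : ℝ) 1) : ℝ) = 1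
      rw [show (⟨γ t₀, hmem t₀⟩ : γ '' univ) = e.symm ⟨1, by simp⟩ from Subtype.ext ht₀,
        e.apply_symm_apply]
    obtain ⟨r, hr, hinj⟩ := h.exists_injOn hγ t₀
    have hfinj : InjOn f (Icc (t₀ - r) (t₀ + r)) := fun s hs t ht hst =>
      hinj hs ht (congrArg Subtype.val (e.injective (Subtype.ext hst)))
    have h0 : t₀ ∈ Icc (t₀ - r) (t₀ + r) := ⟨by linarith, by linarith⟩
    rcases hf.continuousOn.strictMonoOn_of_injOn_Icc' (by linarith) hfinj with hm | hm
    · have := hm h0 (right_mem_Icc.2 (by linarith)) (by linarith)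
      linarith [hf1 (t₀ + r)]
    · have := hm (left_mem_Icc.2 (by linarith)) h0 (by linarith)
      linarith [hf1 (t₀ - r)]
  · obtain ⟨r, hr, hinj⟩ := h.exists_injOn hγ 0
    have hγw : ∀ t, γ t = w := fun t => by simpa [hw] using hmem t
    have := hinj (left_mem_Icc.2 (by linarith)) (right_mem_Icc.2 (by linarith))
      ((hγw _).trans (hγw _).symm)
    linarith

theorem isNonTrapping (h : IsFlowEmbedding g ι V C) (hg : ¬ ∃ γ, IsFlowCurve g γ univ) :
    IsNonTrapping g := by
  refine ⟨fun hc => hg hc.exists_isFlowCurve_univ, fun ⟨γ, J, hγ, hJ⟩ => ?_⟩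
  rw [curveLength_eq_volume g hγ] at hJ
  refine hg (h.exists_complete hγ fun hb => ?_)
  exact hb.measure_lt_top.ne hJ

end IsFlowEmbedding

end Manifold

end GeodesicFlow

/-! ### The main theorem -/

theorem mainTheorem7 {n : ℕ} [NeZero n] {M : Type*} [TopologicalSpace M]
    [ChartedSpace (EuclideanHalfSpace n) M] [IsManifold (𝓡∂ n) ∞ M]
    [T2Space M] [CompactSpace M] [ConnectedSpace M]
    (g : GeodesicFlow.Metric (𝓡∂ n) M) :
    (GeodesicFlow.IsGradientType g ↔
      ∀ T : Set (TangentBundle (𝓡∂ n) M), GeodesicFlow.IsTrajectory g T →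
        Nonempty (T ≃ₜ Set.Icc (0 : ℝ) 1) ∨ ∃ w, T = {w}) ∧
    (GeodesicFlow.IsGradientType g ↔ GeodesicFlow.IsNonTrapping g) := by
  obtain ⟨m, ι, V, C, h⟩ := GeodesicFlow.exists_isFlowEmbedding g
  refine ⟨⟨fun ⟨F, hF⟩ T hT => h.nonempty_homeomorph_of_isLyapunov hF hT, fun hg =>
    h.isGradientType (h.not_exists_isFlowCurve_univ_of_forall_isTrajectory hg)⟩,
    fun ⟨F, hF⟩ => h.isNonTrapping (h.not_exists_isFlowCurve_univ_of_isLyapunov hF), fun hg =>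
    h.isGradientType hg.not_exists_isFlowCurve_univ⟩
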